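/- Let $I=(0,1]$ with Lebesgue measure, all functions complex valued, $h=\chi_{(0,1/2]}-\chi_{(1/2,1]}$. For $f:I\to\mathbb C$ and $n=2^k+j$, $k\ge 0$, $0\le j<2^k$, put $f_n(t)=f(2^kt-j)$ for $t\in(\tfrac{j}{2^k},\tfrac{j+1}{2^k}]$ and $f_n(t)=0$ for other $t\in I$; $\{f_n\}_{n\ge1}$ is the system of dilations and translations of $f$, and $\{h_n\}_{n\ge 1}$ (the case $f=h$) is the Haar system. The Fourier–Haar coefficients of $x\in L^1(I)$ are $\xi_n=2^k\int_0^1xh_n$, $2^k\le n<2^{k+1}$. $BMO_d$ is the space of all $x\in L^2(I)$ with $\int_0^1x=0$ and $$\|x\|_{BMO_d}=\sup_{k\ge0}\omega_k(x)<\infty,\qquad \omega_k(x)=\max_{0\le j<2^k}\Bigl\|x\bigl(\tfrac{j+\cdot}{2^k}\bigr)-\int_0^1x\bigl(\tfrac{j+s}{2^k}\bigr)ds\Bigr\|_{L^2},$$ and $VMO_d=\{x\in BMO_d:\lim_{k\to\infty}\omega_k(x)=0\}$. For $s\ge1$ let $N_s$ be the set of all sums of $s$ distinct powers $2^i$, $i\ge0$.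 For $X\in\{BMO_d,VMO_d\}$, let $\mathcal H^s_{ch}\cap X$ (the Haar chaoses of order $s$ in $X$) be the subspace of those $x\in X$ whose Fourier–Haar coefficients vanish outside $N_s$. Let $f(t)=\sum_{k=0}^\infty c_kh_{2^k}(t)$, $t\in I$, $c_k\in\mathbb C$, be a first-order Haar chaos with $f\in BMO_d$, and let $\hat f(z)=\sum_{k\ge0}c_kz^k$ be its symbol. Let $T_f$ be the linear operator with $T_fh_n=f_n$, i.e. $T_fx=\sum_{n\ge1}\xi_nf_n$ (convergence in $L^2$), where $(\xi_n)$ are the Fourier–Haar coefficients of $x$. **(A)** The following are equivalent: (i) $T_f$ is (well defined and) bounded on $BMO_d$; (ii) for every $s\ge1$, $T_f$ is bounded on $\mathcal H^s_{ch}\cap BMO_d$; (iii) $T_f$ is bounded on $\mathcal H^1_{ch}\cap BMO_d$; (iv) $\hat f\in A_1^+(\mathbb D)$, i.e. $\sum_k|c_k|<\infty$; (v) $f$ has bounded variation on $I$. **(B)** The following are equivalent: (i) $\{f_n\}_{n\ge1}$ is a basis of $VMO_d$ equivalent to the Haar system; (ii) for every $s\ge1$, $\{f_n\}_{n\in N_s}$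 is a basis of $\mathcal H^s_{ch}\cap VMO_d$ equivalent to $\{h_n\}_{n\in N_s}$; (iii) $\{f_{2^k}\}_{k\ge0}$ is a basis of $\mathcal H^1_{ch}\cap VMO_d$ equivalent to $\{h_{2^k}\}_{k\ge0}$; (iv) $\sum_k|c_k|<\infty$ and $\hat f(z)\ne0$ for all $|z|\le1$; (v) $f$ has bounded variation on $I$, $c_0\neq0$, and the dual function $g=\sum_{k\ge0}d_kh_{2^k}$, where $\sum_kd_kz^k=1/\hat f(z)$ as formal power series, has bounded variation on $I$ and mean zero. Here "basis" means Schauder basis in the $BMO_d$-norm, in increasing order of the index $n$ (so in particular the system lies in the space), and two systems $\{u_n\},\{v_n\}$ are equivalent if the $BMO_d$-norms of $\sum a_nu_n$ and $\sum a_nv_n$ are comparable, with constants independent of the finitely supported scalar family $(a_n)$. -/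

import Mathlib

open MeasureTheory Filter Topology
open scoped ENNReal NNReal

noncomputable section

/-- Lebesgue measure on the interval `I = (0,1]`. Functions on `I` are modelled by functions
`ℝ → ℂ`; their values outside `I` never matter. -/
def unitMeasure : Measure ℝ := volume.restrict (Set.Ioc 0 1)

open Classical in
/-- The `n`-th dilation-translation `f_n` of `f`, `n = 2^k + j` with `0 ≤ j < 2^k`:
`f_n(t) = f(2^k t - j)` on `(j/2^k, (j+1)/2^k]` and `0` elsewhere (used for `n ≥ 1` only). -/
def affineTerm (f : ℝ → ℂ) (n : ℕ) (t : ℝ) : ℂ :=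
  let k := Nat.log 2 n
  let j := n - 2 ^ k
  if t ∈ Set.Ioc ((j : ℝ) / 2 ^ k) (((j : ℝ) + 1) / 2 ^ k) then f (2 ^ k * t - j) else 0

open Classical in
/-- The function `h`, equal to `1` on `(0,1/2]`, to `-1` on `(1/2,1]`, and `0` elsewhere. -/
def haarMother (t : ℝ) : ℂ :=
  if t ∈ Set.Ioc (0 : ℝ) (1 / 2) then 1 else if t ∈ Set.Ioc (1 / 2 : ℝ) 1 then -1 else 0

/-- The Haar functions `h_n`, `n ≥ 1`, normalized in the supremum norm. -/
def haarFun (n : ℕ) : ℝ → ℂ := affineTerm haarMother n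

/-- The Fourier-Haar coefficient `ξ_n = 2^k ∫₀¹ x h_n`, where `2^k ≤ n < 2^(k+1)`. -/
def haarCoeff (x : ℝ → ℂ) (n : ℕ) : ℂ :=
  2 ^ Nat.log 2 n * ∫ t, x t * haarFun n t ∂unitMeasure

/-- The set `N_s` of sums of `s` distinct powers of two. -/
def chaosIndex (s : ℕ) : Set ℕ :=
  {n | ∃ e : Finset ℕ, e.card = s ∧ n = ∑ i ∈ e, 2 ^ i}

/-- The first-order Haar chaos `∑ c_k h_{2^k}`. At every point only finitely many terms
are nonzero. -/
def firstChaos (c : ℕ → ℂ) (t : ℝ) : ℂ := ∑' k, c k * haarFun (2 ^ k) t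

/-- The symbol (generating function) `∑ c_k z^k`. -/
def chaosSymbol (c : ℕ → ℂ) (z : ℂ) : ℂ := ∑' k, c k * z ^ k

/-- `d` is the sequence of Taylor coefficients of `1 / ∑ c_k z^k` (as a formal power series);
it exists if and only if `c 0 ≠ 0`, and is then unique. -/
def IsDualCoeff (c d : ℕ → ℂ) : Prop :=
  c 0 * d 0 = 1 ∧ ∀ k, 1 ≤ k → ∑ j ∈ Finset.range (k + 1), c (k - j) * d j = 0

/-- The function `t ↦ x((j+t)/2^k) - ∫₀¹ x((j+s)/2^k) ds`, i.e. `x` minus its mean on the dyadic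
interval `(j/2^k, (j+1)/2^k]`, rescaled to `(0,1]`. -/
def dyadicOsc (x : ℝ → ℂ) (k j : ℕ) (t : ℝ) : ℂ :=
  x (((j : ℝ) + t) / 2 ^ k) - ∫ s, x (((j : ℝ) + s) / 2 ^ k) ∂unitMeasure

/-- The largest `L²`-mean oscillation of `x` over the dyadic intervals of length `2^{-k}`. -/
def levelOsc (x : ℝ → ℂ) (k : ℕ) : ℝ≥0∞ :=
  ⨆ j : Fin (2 ^ k), eLpNorm (dyadicOsc x k j) 2 unitMeasure

/-- The norm of the dyadic space `BMO_d`. -/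
def bmoNorm (x : ℝ → ℂ) : ℝ≥0∞ := ⨆ k, levelOsc x k

/-- The dyadic space `BMO_d` (of mean zero functions). -/
def dyadicBMO : Set (ℝ → ℂ) :=
  {x | MemLp x 2 unitMeasure ∧ ∫ t, x t ∂unitMeasure = 0 ∧ bmoNorm x < ∞}

/-- The dyadic space `VMO_d`. -/
def dyadicVMO : Set (ℝ → ℂ) :=
  {x | x ∈ dyadicBMO ∧ Tendsto (levelOsc x) atTop (𝓝 0)}

/-- The functions whose Fourier-Haar series contains only `h_n` with `n ∈ N_s`; its intersections
with `BMO_d` and `VMO_d` are the subspaces of Haar chaoses of order `s`. -/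
def haarChaos (s : ℕ) : Set (ℝ → ℂ) :=
  {x | ∀ n, 1 ≤ n → n ∉ chaosIndex s → haarCoeff x n = 0}

/-- `y = T_f x`, where `T_f` is the operator sending `h_n` to `f_n`: if `∑ ξ_n h_n` is the
Fourier-Haar series of `x`, then `y = ∑ ξ_n f_n` with convergence in `L²`. -/
def IsMultishiftImage (f x y : ℝ → ℂ) : Prop :=
  Tendsto (fun N : ℕ =>
    eLpNorm (y - ∑ n ∈ Finset.Ico 1 N, haarCoeff x n • affineTerm f n) 2 unitMeasure)
    atTop (𝓝 0)

/-- `T_f` is well defined and bounded on the subspace `X` of `BMO_d`, as an operator `X → X`. -/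
def MultishiftBoundedOn (f : ℝ → ℂ) (X : Set (ℝ → ℂ)) : Prop :=
  ∃ C : ℝ≥0, ∀ x ∈ X, ∃ y ∈ X, IsMultishiftImage f x y ∧ bmoNorm y ≤ C * bmoNorm x

/-- The system `(u_n)`, `n ∈ S`, enumerated in increasing order of `n`, is a (Schauder) basis of
the subspace `X` of `BMO_d`. -/
def IsBmoBasis (X : Set (ℝ → ℂ)) (S : Set ℕ) (u : ℕ → ℝ → ℂ) : Prop :=
  (∀ n ∈ S, u n ∈ X) ∧
  ∀ x ∈ X, ∃! a : ℕ → ℂ, (∀ n, n ∉ S → a n = 0) ∧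
    Tendsto (fun N : ℕ => bmoNorm (x - ∑ n ∈ Finset.range N, a n • u n)) atTop (𝓝 0)

/-- The systems `(u_n)` and `(v_n)`, `n ∈ S`, are equivalent in the norm of `BMO_d`. -/
def BmoEquivalent (S : Set ℕ) (u v : ℕ → ℝ → ℂ) : Prop :=
  ∃ A B : ℝ≥0, 0 < A ∧ ∀ (F : Finset ℕ) (a : ℕ → ℂ), (F : Set ℕ) ⊆ S →
    A * bmoNorm (∑ n ∈ F, a n • v n) ≤ bmoNorm (∑ n ∈ F, a n • u n) ∧
    bmoNorm (∑ n ∈ F, a n • u n) ≤ B * bmoNorm (∑ n ∈ F, a n • v n)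

/-- The system `(f_n)`, `n ∈ S`, of dilations and translations of `f` is a basis of `X`
equivalent to the Haar system `(h_n)`, `n ∈ S`. -/
def IsBasisLikeHaar (f : ℝ → ℂ) (X : Set (ℝ → ℂ)) (S : Set ℕ) : Prop :=
  IsBmoBasis X S (affineTerm f) ∧ BmoEquivalent S (affineTerm f) haarFun

end

/-! Everything is read off Haar coefficients. The index n = 2^k + j is a node of the binary tree
with children 2n and 2n+1. By Parseval on the dyadic interval of a node, the squared L² oscillation
there is `treeEnergy` of the subtree below it (`eLpNorm_dyadicOsc_sq`). So the squared BMO_d norm is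
the supremum of the subtree energies, and VMO_d means that these tend to zero at deep nodes.

With D the operator h_n ↦ h_{2n}, T_f is ∑ c_i D^i (`haarCoeff_affineTerm`). The powers of D are
uniformly bounded: a shift halves the energy of a subtree apart from one root term, so all subtree
energies of D^i ξ are at most 2B when those of ξ are at most B. Hence ∑|c_i| < ∞ gives boundedness
of T_f, and D preserves VMO_d and every set of indices stable under doubling, such as N_s.

Conversely, a first-order chaos meets each level of a subtree in at most one node, so its norm is
comparable to the supremum of its coefficients. There T_f is convolution by c on bounded sequences,
and testing on unimodular phases yields ∑|c_i| < ∞ (`summable_norm_of_convolution_le`). Finite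
chaoses suffice for this, so one argument serves BMO_d, VMO_d and their chaos subspaces.

For bases, the chains {2^e q}, q odd, are invariant, and T_f acts on each as multiplication by the
power series of c. Its inverse is therefore T_g, with g built from the formal inverse d of c. A
basis equivalent to the Haar system forces convolution by d to be bounded, so ∑|d_k| < ∞ and the
symbol has no zero in the closed disc. The converse is Wiener's lemma (`exists_summable_inverse`),
proved by Gelfand theory in the closed algebra generated by the right shift.

Bounded variation enters because f is constant on each shell (2^{-m-1}, 2^{-m}], with jumps 2c_k -
c_{k+1}. The variation is ∑|2c_k - c_{k+1}|, which controls ∑|c_k| once c is known to be bounded;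
mean zero supplies that bound. -/

noncomputable section

/-! ### Subtree energies and their behaviour under the shift n ↦ 2n -/

/-- The weighted energy of the coefficients in the subtree with root `m`. -/
def treeEnergy (ξ : ℕ → ℂ) (m : ℕ) : ℝ≥0∞ :=
  ∑' l : ℕ, (2 ^ l : ℝ≥0∞)⁻¹ * ∑ r ∈ Finset.range (2 ^ l), ‖ξ (2 ^ l * m + r)‖ₑ ^ 2

/-- The coefficient sequence of `∑ ξ_n h_{2n}`. -/
def doubleShift (ξ : ℕ → ℂ) (m : ℕ) : ℂ := if Even m then ξ (m / 2) else 0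

/-- The coefficient sequence of `∑ ξ_n f_n`, where `f = ∑ c_k h_{2^k}`. -/
def multishift (c ξ : ℕ → ℂ) (m : ℕ) : ℂ := ∑ i ∈ Finset.range m, c i * doubleShift^[i] ξ m

/-- The sequence `ξ` with its entries of index below `N` removed. -/
def seqTail (ξ : ℕ → ℂ) (N m : ℕ) : ℂ := if N ≤ m then ξ m else 0

theorem sum_range_two_mul {M : Type*} [AddCommMonoid M] (g : ℕ → M) (n : ℕ) :
    ∑ r ∈ Finset.range (2 * n), g r = ∑ r ∈ Finset.range n, (g (2 * r) + g (2 * r + 1)) := by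
  induction n with
  | zero => simp
  | succ n ih =>
    rw [Finset.sum_range_succ, ← ih, show 2 * (n + 1) = 2 * n + 1 + 1 by ring,
      Finset.sum_range_succ, Finset.sum_range_succ, add_assoc]

theorem treeEnergy_mono {ξ η : ℕ → ℂ} {m : ℕ} (h : ∀ n, m ≤ n → ‖ξ n‖ₑ ≤ ‖η n‖ₑ) :
    treeEnergy ξ m ≤ treeEnergy η m := by
  refine ENNReal.tsum_le_tsum fun l => ?_
  gcongr with r
  refine h _ ?_
  have : 1 * m ≤ 2 ^ l * m := Nat.mul_le_mul_right _ Nat.one_le_two_pow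
  omega

theorem treeEnergy_congr {ξ η : ℕ → ℂ} {m : ℕ} (h : ∀ n, m ≤ n → ξ n = η n) :
    treeEnergy ξ m = treeEnergy η m :=
  le_antisymm (treeEnergy_mono fun n hn => (by rw [h n hn]))
    (treeEnergy_mono fun n hn => (by rw [h n hn]))

theorem enorm_sq_le_treeEnergy (ξ : ℕ → ℂ) (m : ℕ) : ‖ξ m‖ₑ ^ 2 ≤ treeEnergy ξ m := by
  have := ENNReal.le_tsum (f := fun l : ℕ => (2 ^ l : ℝ≥0∞)⁻¹ *
    ∑ r ∈ Finset.range (2 ^ l), ‖ξ (2 ^ l * m + r)‖ₑ ^ 2) 0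
  simpa [treeEnergy] using this

theorem two_pow_succ_inv (l : ℕ) : (2 ^ (l + 1) : ℝ≥0∞)⁻¹ = 2⁻¹ * (2 ^ l : ℝ≥0∞)⁻¹ := by
  rw [pow_succ', ENNReal.mul_inv (by simp) (by simp)]

theorem treeEnergy_eq (ξ : ℕ → ℂ) (m : ℕ) : treeEnergy ξ m =
    ‖ξ m‖ₑ ^ 2 + 2⁻¹ * (treeEnergy ξ (2 * m) + treeEnergy ξ (2 * m + 1)) := by
  unfold treeEnergy
  rw [tsum_eq_zero_add' ENNReal.summable]
  congr 1
  · simp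
  rw [← ENNReal.tsum_add, ← ENNReal.tsum_mul_left]
  refine tsum_congr fun l => ?_
  rw [two_pow_succ_inv, mul_assoc, ← mul_add]
  congr 2
  rw [show (2 : ℕ) ^ (l + 1) = 2 ^ l + 2 ^ l by ring, Finset.sum_range_add]
  congr 1 <;> refine Finset.sum_congr rfl fun r _ => ?_ <;> congr 3 <;> ring

theorem doubleShift_two_mul (ξ : ℕ → ℂ) (m : ℕ) : doubleShift ξ (2 * m) = ξ m := by
  simp [doubleShift]

theorem doubleShift_two_mul_add_one (ξ : ℕ → ℂ) (m : ℕ) : doubleShift ξ (2 * m + 1) = 0 := by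
  simp [doubleShift]

theorem treeEnergy_doubleShift (ξ : ℕ → ℂ) (m : ℕ) : treeEnergy (doubleShift ξ) m =
    ‖doubleShift ξ m‖ₑ ^ 2 + 2⁻¹ * treeEnergy ξ m := by
  unfold treeEnergy
  rw [tsum_eq_zero_add' ENNReal.summable]
  congr 1
  · simp
  rw [← ENNReal.tsum_mul_left]
  refine tsum_congr fun l => ?_
  rw [two_pow_succ_inv, mul_assoc]
  congr 2
  rw [pow_succ', sum_range_two_mul]
  refine Finset.sum_congr rfl fun r _ => ?_
  rw [show 2 * 2 ^ l * m + 2 * r = 2 * (2 ^ l * m + r) by ring,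
    show 2 * 2 ^ l * m + (2 * r + 1) = 2 * (2 ^ l * m + r) + 1 by ring,
    doubleShift_two_mul, doubleShift_two_mul_add_one]
  simp

theorem doubleShift_iterate (ξ : ℕ → ℂ) (i m : ℕ) :
    doubleShift^[i] ξ m = if 2 ^ i ∣ m then ξ (m / 2 ^ i) else 0 := by
  induction i generalizing m with
  | zero => simp
  | succ i ih =>
    rw [Function.iterate_succ_apply']
    obtain ⟨n, rfl | rfl⟩ := Nat.even_or_odd' m
    · rw [doubleShift_two_mul, ih, pow_succ']
      simp [Nat.mul_div_mul_left, Nat.mul_dvd_mul_iff_left]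
    · rw [doubleShift_two_mul_add_one, if_neg]
      intro h
      have := (dvd_pow_self 2 (Nat.succ_ne_zero i)).trans h
      omega

theorem div_two_pow_pos {i m : ℕ} (hm : 1 ≤ m) (h : 2 ^ i ∣ m) : 1 ≤ m / 2 ^ i :=
  Nat.div_pos (Nat.le_of_dvd hm h) (by positivity)

theorem inv_two_mul_two_mul (B : ℝ≥0∞) : 2⁻¹ * (2 * B) = B := by
  rw [← mul_assoc, ENNReal.inv_mul_cancel (by simp) (by simp), one_mul]

/-- One more shift halves the energy and adds a root term |ξ_{m/2^i}|² ≤ B; the bound 2B reproduces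
itself because B + ½·2B = 2B. The bound is uniform in the number of shifts. -/
theorem treeEnergy_iterate_le {ξ : ℕ → ℂ} {B : ℝ≥0∞} (hB : ∀ m, 1 ≤ m → treeEnergy ξ m ≤ B)
    (i m : ℕ) (hm : 1 ≤ m) : treeEnergy (doubleShift^[i] ξ) m ≤ 2 * B := by
  induction i with
  | zero => exact (hB m hm).trans (by rw [two_mul]; exact le_self_add)
  | succ i ih =>
    rw [Function.iterate_succ_apply', treeEnergy_doubleShift, two_mul]
    rw [← Function.iterate_succ_apply' doubleShift, doubleShift_iterate]
    refine add_le_add ?_ ?_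
    · split_ifs with h
      · exact (enorm_sq_le_treeEnergy _ _).trans (hB _ (div_two_pow_pos hm h))
      · simp
    · calc 2⁻¹ * treeEnergy (doubleShift^[i] ξ) m ≤ 2⁻¹ * (2 * B) := by gcongr
        _ = B := inv_two_mul_two_mul B

/-- Same recursion as `treeEnergy_iterate_le`; i shifts lower a node by only i levels, so below
level K + i all root terms still come from below level K. -/
theorem treeEnergy_iterate_le_of_deep {ξ : ℕ → ℂ} {ε : ℝ≥0∞} {K : ℕ}
    (hε : ∀ m, 2 ^ K ≤ m → treeEnergy ξ m ≤ ε) (i m : ℕ) (hm : 2 ^ (K + i) ≤ m) :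
    treeEnergy (doubleShift^[i] ξ) m ≤ 2 * ε := by
  induction i with
  | zero => exact (hε m hm).trans (by rw [two_mul]; exact le_self_add)
  | succ i ih =>
    have h1 : 2 ^ (K + i) ≤ m :=
      (Nat.pow_le_pow_right (by norm_num) (by omega)).trans hm
    rw [Function.iterate_succ_apply', treeEnergy_doubleShift, two_mul]
    rw [← Function.iterate_succ_apply' doubleShift, doubleShift_iterate]
    refine add_le_add ?_ ?_
    · split_ifs with h
      · refine (enorm_sq_le_treeEnergy _ _).trans (hε _ ?_)
        rw [Nat.le_div_iff_mul_le (by positivity), ← pow_add]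
        exact hm
      · simp
    · calc 2⁻¹ * treeEnergy (doubleShift^[i] ξ) m ≤ 2⁻¹ * (2 * ε) := by
            gcongr; exact ih h1
        _ = ε := inv_two_mul_two_mul ε

/-- At the root of the whole tree the shifted sequence has no coefficient, so no root term appears:
D contracts in L². This controls the L² convergence of ∑ ξ_n f_n. -/
theorem treeEnergy_iterate_one_le (ξ : ℕ → ℂ) (i : ℕ) :
    treeEnergy (doubleShift^[i] ξ) 1 ≤ treeEnergy ξ 1 := by
  induction i with
  | zero => exact le_rfl
  | succ i ih =>
    rw [Function.iterate_succ_apply', treeEnergy_doubleShift,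
      show doubleShift (doubleShift^[i] ξ) 1 = 0 from doubleShift_two_mul_add_one _ 0]
    calc ‖(0 : ℂ)‖ₑ ^ 2 + 2⁻¹ * treeEnergy (doubleShift^[i] ξ) 1
        ≤ 0 + 1 * treeEnergy ξ 1 := by
          gcongr
          · simp
          · simp
      _ = _ := by simp

/-- Cauchy–Schwarz with weights |a_i|, which keeps the estimate linear in the energies and thus
avoids square roots when summing over the tree. -/
theorem enorm_sum_mul_sq_le {ι : Type*} (s : Finset ι) (a v : ι → ℂ) :
    ‖∑ i ∈ s, a i * v i‖ₑ ^ 2 ≤ (∑ i ∈ s, ‖a i‖ₑ) * ∑ i ∈ s, ‖a i‖ₑ * ‖v i‖ₑ ^ 2 := by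
  have h1 : ‖∑ i ∈ s, a i * v i‖₊ ≤ ∑ i ∈ s, ‖a i‖₊ * ‖v i‖₊ :=
    (nnnorm_sum_le _ _).trans (Finset.sum_le_sum fun i _ => nnnorm_mul_le _ _)
  have h2 : (∑ i ∈ s, ‖a i‖₊ * ‖v i‖₊) ^ 2 ≤
      (∑ i ∈ s, ‖a i‖₊) * ∑ i ∈ s, ‖a i‖₊ * ‖v i‖₊ ^ 2 :=
    Finset.sum_sq_le_sum_mul_sum_of_sq_le_mul _ (fun _ _ => by positivity)
      (fun _ _ => by positivity) fun i _ => (by ring_nf; rfl)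
  have h3 := (pow_le_pow_left₀ (by positivity) h1 2).trans h2
  simp only [enorm_eq_nnnorm]
  exact_mod_cast h3

theorem treeEnergy_multishift_le (c ξ : ℕ → ℂ) (m : ℕ) : treeEnergy (multishift c ξ) m ≤
    (∑' i, ‖c i‖ₑ) * ∑' i, ‖c i‖ₑ * treeEnergy (doubleShift^[i] ξ) m := by
  have key : ∀ n, ‖multishift c ξ n‖ₑ ^ 2 ≤
      (∑' i, ‖c i‖ₑ) * ∑' i, ‖c i‖ₑ * ‖doubleShift^[i] ξ n‖ₑ ^ 2 := fun n =>
    (enorm_sum_mul_sq_le _ _ _).trans (mul_le_mul' (ENNReal.sum_le_tsum _) (ENNReal.sum_le_tsum _))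
  calc treeEnergy (multishift c ξ) m
      ≤ ∑' l : ℕ, (2 ^ l : ℝ≥0∞)⁻¹ * ∑ r ∈ Finset.range (2 ^ l), (∑' i, ‖c i‖ₑ) *
          ∑' i, ‖c i‖ₑ * ‖doubleShift^[i] ξ (2 ^ l * m + r)‖ₑ ^ 2 := by
        unfold treeEnergy
        gcongr
        exact key _
    _ = _ := by
        simp_rw [← Finset.mul_sum, mul_left_comm _ (∑' i, ‖c i‖ₑ)]
        rw [ENNReal.tsum_mul_left]
        congr 1
        unfold treeEnergy
        simp_rw [← ENNReal.tsum_mul_left]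
        rw [ENNReal.tsum_comm]
        refine tsum_congr fun l => ?_
        rw [← Summable.tsum_finsetSum fun _ _ => ENNReal.summable, ← ENNReal.tsum_mul_left]
        refine tsum_congr fun i => ?_
        rw [← Finset.mul_sum]
        ring

theorem treeEnergy_multishift_le_of_le {c ξ : ℕ → ℂ} {B : ℝ≥0∞}
    (hB : ∀ m, 1 ≤ m → treeEnergy ξ m ≤ B) (m : ℕ) (hm : 1 ≤ m) :
    treeEnergy (multishift c ξ) m ≤ (∑' i, ‖c i‖ₑ) ^ 2 * (2 * B) := by
  refine (treeEnergy_multishift_le c ξ m).trans ?_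
  rw [pow_two, mul_assoc]
  refine mul_le_mul' le_rfl ?_
  rw [← ENNReal.tsum_mul_right]
  gcongr
  exact treeEnergy_iterate_le hB _ m hm

theorem treeEnergy_multishift_one_le (c ξ : ℕ → ℂ) :
    treeEnergy (multishift c ξ) 1 ≤ (∑' i, ‖c i‖ₑ) ^ 2 * treeEnergy ξ 1 := by
  refine (treeEnergy_multishift_le c ξ 1).trans ?_
  rw [pow_two, mul_assoc]
  refine mul_le_mul' le_rfl ?_
  rw [← ENNReal.tsum_mul_right]
  gcongr
  exact treeEnergy_iterate_one_le _ _

/-- The energies of the subtrees of `ξ` are bounded. -/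
def BddEnergy (ξ : ℕ → ℂ) : Prop := ∃ B : ℝ≥0∞, B < ∞ ∧ ∀ m, 1 ≤ m → treeEnergy ξ m ≤ B

/-- The energies of the subtrees of `ξ` tend to zero. -/
def VanishingEnergy (ξ : ℕ → ℂ) : Prop :=
  ∀ ε : ℝ≥0∞, 0 < ε → ∃ K : ℕ, ∀ m, 2 ^ K ≤ m → treeEnergy ξ m ≤ ε

theorem tendsto_mul_zero_of_ne_top {a : ℝ≥0∞} (ha : a ≠ ∞) {u : ℕ → ℝ≥0∞}
    (hu : Tendsto u atTop (𝓝 0)) : Tendsto (fun n => a * u n) atTop (𝓝 0) := by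
  simpa using ENNReal.Tendsto.const_mul hu (Or.inr ha)

theorem exists_pos_mul_le {a ε : ℝ≥0∞} (ha : a ≠ ∞) (hε : ε ≠ 0) :
    ∃ δ : ℝ≥0∞, 0 < δ ∧ a * δ ≤ ε := by
  rcases eq_or_ne a 0 with rfl | h0
  · exact ⟨1, one_pos, by simp⟩
  · exact ⟨ε / a, ENNReal.div_pos hε ha, ENNReal.mul_div_le⟩

/-- Split the sum at L. The terms i ≥ L are small because the tail of ∑|c_i| is; the finitely many
others move coefficients down by fewer than L levels, so deep subtrees of the image only see deep
subtrees of ξ. -/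
theorem VanishingEnergy.multishift {c ξ : ℕ → ℂ} (hc : ∑' i, ‖c i‖ₑ ≠ ∞) (hξ : BddEnergy ξ)
    (h : VanishingEnergy ξ) : VanishingEnergy (multishift c ξ) := by
  intro ε hε
  obtain ⟨B, hB, hξ⟩ := hξ
  set C := ∑' i, ‖c i‖ₑ with hC
  have hC2 : C * C * 2 ≠ ∞ := by finiteness
  have hε2 : ε / 2 ≠ 0 := (ENNReal.half_pos hε.ne').ne'
  obtain ⟨δ, hδ, hδ'⟩ := exists_pos_mul_le hC2 hε2
  have htail := ENNReal.tendsto_sum_nat_add (fun i => ‖c i‖ₑ) hc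
  have htail' := tendsto_mul_zero_of_ne_top (a := C * (2 * B)) (by finiteness) htail
  obtain ⟨L, hL⟩ := (htail'.eventually (ge_mem_nhds (pos_iff_ne_zero.2 hε2))).exists
  obtain ⟨K, hK⟩ := h δ hδ
  refine ⟨K + L, fun m hm => (treeEnergy_multishift_le c ξ m).trans ?_⟩
  have hm1 : 1 ≤ m := Nat.one_le_two_pow.trans hm
  rw [← ENNReal.summable.sum_add_tsum_nat_add' (k := L) (f := fun i => ‖c i‖ₑ *
    treeEnergy (doubleShift^[i] ξ) m), mul_add, ← ENNReal.add_halves ε]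
  refine add_le_add ?_ ?_
  · calc C * ∑ i ∈ Finset.range L, ‖c i‖ₑ * treeEnergy (doubleShift^[i] ξ) m
        ≤ C * ∑ i ∈ Finset.range L, ‖c i‖ₑ * (2 * δ) := by
          gcongr with i hi
          refine treeEnergy_iterate_le_of_deep hK i m (le_trans ?_ hm)
          exact Nat.pow_le_pow_right (by norm_num) (by simp at hi; omega)
      _ ≤ C * (C * (2 * δ)) := by
          rw [← Finset.sum_mul]
          gcongr
          exact ENNReal.sum_le_tsum _
      _ = C * C * 2 * δ := by ring
      _ ≤ ε / 2 := hδ'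
  · calc C * ∑' i, ‖c (i + L)‖ₑ * treeEnergy (doubleShift^[i + L] ξ) m
        ≤ C * ∑' i, ‖c (i + L)‖ₑ * (2 * B) := by
          gcongr
          exact treeEnergy_iterate_le hξ _ m hm1
      _ = C * (2 * B) * ∑' i, ‖c (i + L)‖ₑ := by rw [ENNReal.tsum_mul_right]; ring
      _ ≤ ε / 2 := hL

theorem BddEnergy.multishift {c ξ : ℕ → ℂ} (hc : ∑' i, ‖c i‖ₑ ≠ ∞) (hξ : BddEnergy ξ) :
    BddEnergy (multishift c ξ) := by
  obtain ⟨B, hB, hξ⟩ := hξ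
  exact ⟨_, by finiteness, fun m hm => treeEnergy_multishift_le_of_le hξ m hm⟩

/-- Deep subtrees only lose coefficients. A node above level K has its own coefficient removed, so
its energy is the average of those of its two children; the bound climbs from level K to the root.
-/
theorem treeEnergy_seqTail_le {ξ : ℕ → ℂ} {ε : ℝ≥0∞} {K N : ℕ}
    (hε : ∀ m, 2 ^ K ≤ m → treeEnergy ξ m ≤ ε) (hN : 2 ^ K ≤ N) (m : ℕ) (hm : 1 ≤ m) :
    treeEnergy (seqTail ξ N) m ≤ ε := by
  by_cases h : 2 ^ K ≤ m
  · refine (treeEnergy_mono fun n _ => ?_).trans (hε m h)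
    unfold seqTail; split_ifs <;> simp
  · rw [treeEnergy_eq, seqTail, if_neg (by omega)]
    have h1 := treeEnergy_seqTail_le hε hN (2 * m) (by omega)
    have h2 := treeEnergy_seqTail_le hε hN (2 * m + 1) (by omega)
    calc ‖(0 : ℂ)‖ₑ ^ 2 + 2⁻¹ * (treeEnergy (seqTail ξ N) (2 * m) +
          treeEnergy (seqTail ξ N) (2 * m + 1)) ≤ 0 + 2⁻¹ * (ε + ε) := by
          gcongr
          simp
      _ = ε := by rw [← two_mul, inv_two_mul_two_mul, zero_add]
termination_by 2 ^ K - m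

theorem tendsto_treeEnergy_seqTail {ξ : ℕ → ℂ} (h : treeEnergy ξ 1 ≠ ∞) :
    Tendsto (fun N => treeEnergy (seqTail ξ N) 1) atTop (𝓝 0) := by
  have h1 := ENNReal.tendsto_sum_nat_add _ h
  have h2 : Tendsto (fun N => Nat.log 2 N) atTop atTop :=
    tendsto_atTop_atTop.2 fun b => ⟨2 ^ b, fun a ha =>
      (Nat.log_pow one_lt_two b).ge.trans (Nat.log_mono_right ha)⟩
  refine tendsto_of_tendsto_of_tendsto_of_le_of_le' tendsto_const_nhds (h1.comp h2)
    (Eventually.of_forall fun _ => zero_le) ?_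
  filter_upwards [eventually_ge_atTop 1] with N hN
  unfold treeEnergy
  rw [← ENNReal.summable.sum_add_tsum_nat_add' (k := Nat.log 2 N), Finset.sum_eq_zero, zero_add]
  · simp only [Function.comp]
    gcongr
    unfold seqTail; split_ifs <;> simp
  · intro l hl
    rw [Finset.sum_eq_zero, mul_zero]
    intro r hr
    have : 2 ^ (l + 1) ≤ N := (Nat.pow_le_pow_right (by norm_num)
      (by simp at hl; omega)).trans (Nat.pow_log_le_self 2 (by omega))
    rw [seqTail, if_neg]
    · simp
    · simp at hr
      rw [pow_succ] at this
      omega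

/-! ### Action on the chains 2^e q as multiplication of power series -/

theorem isDualCoeff_iff {c d : ℕ → ℂ} :
    IsDualCoeff c d ↔ PowerSeries.mk c * PowerSeries.mk d = 1 := by
  have key : ∀ k, PowerSeries.coeff k (PowerSeries.mk c * PowerSeries.mk d) =
      ∑ j ∈ Finset.range (k + 1), c (k - j) * d j := fun k => by
    rw [mul_comm, PowerSeries.coeff_mul, Finset.Nat.sum_antidiagonal_eq_sum_range_succ
      (fun i j => PowerSeries.coeff i (PowerSeries.mk d) * PowerSeries.coeff j (PowerSeries.mk c))]
    simp [mul_comm]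
  rw [PowerSeries.ext_iff]
  simp_rw [key, PowerSeries.coeff_one]
  constructor
  · rintro ⟨h0, h1⟩ k
    rcases Nat.eq_zero_or_pos k with rfl | hk
    · simpa using h0
    · rw [if_neg hk.ne', h1 k hk]
  · intro h
    refine ⟨by simpa using h 0, fun k hk => ?_⟩
    rw [h k, if_neg (by omega)]

theorem exists_mk_mul_eq_one {c : ℕ → ℂ} (h : c 0 ≠ 0) :
    ∃ d : ℕ → ℂ, PowerSeries.mk c * PowerSeries.mk d = 1 := by
  refine ⟨fun n => PowerSeries.coeff n (PowerSeries.mk c)⁻¹, ?_⟩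
  have : PowerSeries.mk (fun n => PowerSeries.coeff n (PowerSeries.mk c)⁻¹) =
    (PowerSeries.mk c)⁻¹ := by ext; simp
  rw [this]
  exact PowerSeries.mul_inv_cancel _ (by simpa using h)

/-- Doubling moves a chain {2^e q}, q odd, one step along itself, hence acts on it as multiplication
by the variable. Inverting T_f thereby reduces to inverting a formal power series. -/
theorem multishift_two_pow_mul (c ξ : ℕ → ℂ) {q : ℕ} (hq : Odd q) (e : ℕ) :
    multishift c ξ (2 ^ e * q) = PowerSeries.coeff e
      (PowerSeries.mk c * PowerSeries.mk fun j => ξ (2 ^ j * q)) := by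
  have hq0 : 1 ≤ q := hq.pos
  have hlt : e + 1 ≤ 2 ^ e * q := calc
    e + 1 ≤ 2 ^ e * 1 := by have := Nat.lt_two_pow_self (n := e); omega
    _ ≤ 2 ^ e * q := Nat.mul_le_mul_left _ hq0
  rw [PowerSeries.coeff_mul, Finset.Nat.sum_antidiagonal_eq_sum_range_succ
      (fun i j => PowerSeries.coeff i (PowerSeries.mk c) *
        PowerSeries.coeff j (PowerSeries.mk fun j => ξ (2 ^ j * q))), multishift]
  symm
  -- The cutoff i < m in `multishift` loses nothing: 2^i divides 2^e q only for i ≤ e, and e < 2^e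
  -- q.
  refine Finset.sum_subset_zero_on_sdiff (Finset.range_subset_range.2 hlt) ?_ ?_
  · intro i hi
    rw [doubleShift_iterate, if_neg, mul_zero]
    intro h
    have h2 : 2 ^ i ∣ 2 ^ e :=
      Nat.Coprime.dvd_of_dvd_mul_right (Nat.Coprime.pow_left i (Nat.coprime_two_left.2 hq)) h
    have := (Nat.pow_dvd_pow_iff_le_right (by norm_num)).1 h2
    simp at hi
    omega
  · intro i hi
    have hi' : i ≤ e := by simp at hi; omega
    have : 2 ^ e * q = 2 ^ i * (2 ^ (e - i) * q) := by
      rw [← mul_assoc, ← pow_add]; congr 2; omega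
    rw [doubleShift_iterate, this, if_pos (dvd_mul_right _ _),
      Nat.mul_div_cancel_left _ (by positivity)]
    simp

theorem exists_two_pow_mul_odd {m : ℕ} (hm : 1 ≤ m) : ∃ e q, Odd q ∧ m = 2 ^ e * q := by
  obtain ⟨e, q, hq, h⟩ := Nat.exists_eq_two_pow_mul_odd (n := m) (by omega)
  exact ⟨e, q, hq, h⟩

theorem multishift_multishift {c d : ℕ → ℂ} (h : PowerSeries.mk c * PowerSeries.mk d = 1)
    (ξ : ℕ → ℂ) {m : ℕ} (hm : 1 ≤ m) : multishift c (multishift d ξ) m = ξ m := by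
  obtain ⟨e, q, hq, rfl⟩ := exists_two_pow_mul_odd hm
  have : (PowerSeries.mk fun j => multishift d ξ (2 ^ j * q)) =
      PowerSeries.mk d * PowerSeries.mk fun j => ξ (2 ^ j * q) := by
    ext j
    rw [PowerSeries.coeff_mk, multishift_two_pow_mul d ξ hq]
  rw [multishift_two_pow_mul c _ hq, this, ← mul_assoc, h, one_mul, PowerSeries.coeff_mk]

theorem multishift_congr {c ξ η : ℕ → ℂ} {m : ℕ} (hm : 1 ≤ m)
    (h : ∀ n, 1 ≤ n → n ≤ m → ξ n = η n) : multishift c ξ m = multishift c η m := by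
  refine Finset.sum_congr rfl fun i _ => ?_
  rw [doubleShift_iterate, doubleShift_iterate]
  split_ifs with hd
  · rw [h _ (div_two_pow_pos hm hd) (Nat.div_le_self _ _)]
  · rfl

/-- This gives invariance of the chaos subspaces: the entry at m only involves entries at m / 2^i,
and from such an index in S doubling would lead back to m in S. -/
theorem multishift_eq_zero_of_notMem {S : Set ℕ} (hS : ∀ n, n ∈ S → 2 * n ∈ S) {c ξ : ℕ → ℂ}
    (hξ : ∀ n, 1 ≤ n → n ∉ S → ξ n = 0) {m : ℕ} (hm : 1 ≤ m) (hmS : m ∉ S) :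
    multishift c ξ m = 0 := by
  refine Finset.sum_eq_zero fun i hi => ?_
  rw [doubleShift_iterate]
  split_ifs with hd
  · rw [hξ _ (div_two_pow_pos hm hd), mul_zero]
    obtain ⟨n, rfl⟩ := hd
    rw [Nat.mul_div_cancel_left _ (by positivity)]
    intro hn
    refine hmS ?_
    clear hmS hm hi
    induction i with
    | zero => simpa
    | succ i ih => rw [pow_succ', mul_assoc]; exact hS _ ih
  · simp

theorem doubleShift_iterate_sum {ι : Type*} (F : Finset ι) (a : ι → ℂ) (v : ι → ℕ → ℂ) (i m : ℕ) :
    doubleShift^[i] (fun n => ∑ k ∈ F, a k * v k n) m = ∑ k ∈ F, a k * doubleShift^[i] (v k) m := by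
  simp_rw [doubleShift_iterate]
  split_ifs <;> simp

theorem multishift_sum {ι : Type*} (c : ℕ → ℂ) (F : Finset ι) (a : ι → ℂ) (v : ι → ℕ → ℂ) (m : ℕ) :
    multishift c (fun n => ∑ k ∈ F, a k * v k n) m = ∑ k ∈ F, a k * multishift c (v k) m := by
  unfold multishift
  simp_rw [doubleShift_iterate_sum, Finset.mul_sum]
  rw [Finset.sum_comm]
  refine Finset.sum_congr rfl fun k _ => Finset.sum_congr rfl fun i _ => by ring

theorem multishift_sub (c ξ η : ℕ → ℂ) (m : ℕ) :
    multishift c (fun n => ξ n - η n) m = multishift c ξ m - multishift c η m := by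
  unfold multishift
  rw [← Finset.sum_sub_distrib]
  refine Finset.sum_congr rfl fun i _ => ?_
  simp_rw [doubleShift_iterate]
  split_ifs <;> ring

/-! ### Convolution on bounded sequences and Wiener's lemma -/

/-- Duality between absolutely summable and bounded sequences, through convolution. -/
theorem summable_norm_of_convolution_le {d : ℕ → ℂ} {C : ℝ}
    (h : ∀ x : ℕ → ℂ, (∀ j, ‖x j‖ ≤ 1) → ∀ m,
      ‖PowerSeries.coeff m (PowerSeries.mk d * PowerSeries.mk x)‖ ≤ C) :
    Summable fun k => ‖d k‖ := by
  refine summable_of_sum_range_le (c := C) (fun _ => norm_nonneg _) fun n => ?_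
  -- The conjugate phases of d, in reversed order, turn the n-th convolution coefficient into ∑_{k ≤
  -- n} |d_k|. Where d vanishes the division by zero gives 0, which is harmless.
  let x : ℕ → ℂ := fun j => (starRingEnd ℂ) (d (n - j)) / ‖d (n - j)‖
  have hx : ∀ j, ‖x j‖ ≤ 1 := fun j => by
    simp only [x, norm_div, RCLike.norm_conj, Complex.norm_real, norm_norm]
    exact div_self_le_one _
  have hprod : ∀ z : ℂ, z * ((starRingEnd ℂ) z / ‖z‖) = ‖z‖ := fun z => by
    rcases eq_or_ne z 0 with rfl | hz
    · simp
    · have : (‖z‖ : ℂ) ≠ 0 := by simpa using hz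
      rw [← mul_div_assoc, Complex.mul_conj, Complex.normSq_eq_norm_sq]
      field_simp
      push_cast; ring
  have := h x hx n
  rw [PowerSeries.coeff_mul, Finset.Nat.sum_antidiagonal_eq_sum_range_succ
      (fun i j => PowerSeries.coeff i (PowerSeries.mk d) *
        PowerSeries.coeff j (PowerSeries.mk x))] at this
  have heq : ∑ k ∈ Finset.range n.succ, PowerSeries.coeff k (PowerSeries.mk d) *
      PowerSeries.coeff (n - k) (PowerSeries.mk x) =
      ((∑ k ∈ Finset.range n.succ, ‖d k‖ : ℝ) : ℂ) := by
    push_cast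
    refine Finset.sum_congr rfl fun k hk => ?_
    have hk' : n - (n - k) = k := by simp at hk; omega
    simp only [PowerSeries.coeff_mk, x, hk', hprod]
  rw [heq, Complex.norm_real, Real.norm_of_nonneg (Finset.sum_nonneg fun _ _ => norm_nonneg _),
    Finset.sum_range_succ] at this
  linarith [norm_nonneg (d n)]

/-- The right shift on bounded sequences. -/
def rightShift : BoundedContinuousFunction ℕ ℂ →L[ℂ] BoundedContinuousFunction ℕ ℂ :=
  LinearMap.mkContinuous
    { toFun := fun u => BoundedContinuousFunction.ofNormedAddCommGroupDiscrete
        (fun k => if k = 0 then 0 else u (k - 1)) ‖u‖ (fun k => by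
          split_ifs
          · simp
          · exact u.norm_coe_le_norm _)
      map_add' := fun u v => by
        ext k
        by_cases hk : k = 0 <;> simp [hk]
      map_smul' := fun a u => by
        ext k
        by_cases hk : k = 0 <;> simp [hk] } 1 (fun u => by
    rw [one_mul]
    refine (BoundedContinuousFunction.norm_le (norm_nonneg _)).2 fun k => ?_
    by_cases hk : k = 0
    · simp [hk]
    · simpa [hk] using u.norm_coe_le_norm _)

theorem rightShift_apply (u : BoundedContinuousFunction ℕ ℂ) (k : ℕ) :
    rightShift u k = if k = 0 then 0 else u (k - 1) := rfl

theorem norm_rightShift_le : ‖rightShift‖ ≤ 1 :=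
  LinearMap.mkContinuous_norm_le _ zero_le_one _

theorem rightShift_pow_apply (i : ℕ) (u : BoundedContinuousFunction ℕ ℂ) (k : ℕ) :
    (rightShift ^ i) u k = if i ≤ k then u (k - i) else 0 := by
  induction i generalizing k with
  | zero => simp
  | succ i ih =>
    rw [pow_succ']
    change rightShift ((rightShift ^ i) u) k = _
    rw [rightShift_apply]
    rcases Nat.eq_zero_or_pos k with rfl | hk
    · simp
    · rw [if_neg hk.ne', ih]
      by_cases h : i + 1 ≤ k
      · rw [if_pos h, if_pos (by omega)]; congr 1; omega
      · rw [if_neg h, if_neg (by omega)]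

theorem norm_pow_le_one {A : Type*} [NormedRing A] [NormOneClass A] {a : A} (ha : ‖a‖ ≤ 1) (i : ℕ) :
    ‖a ^ i‖ ≤ 1 := (norm_pow_le a i).trans (pow_le_one₀ (norm_nonneg _) ha)

theorem summable_smul_pow {A : Type*} [NormedRing A] [NormOneClass A] [NormedAlgebra ℂ A]
    [CompleteSpace A] {c : ℕ → ℂ} (hc : Summable fun k => ‖c k‖) {a : A} (ha : ‖a‖ ≤ 1) :
    Summable fun i => c i • a ^ i := by
  refine Summable.of_norm_bounded hc fun i => ?_
  rw [norm_smul]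
  exact mul_le_of_le_one_right (norm_nonneg _) (norm_pow_le_one ha i)

theorem summable_symbol {c : ℕ → ℂ} (hc : Summable fun k => ‖c k‖) {z : ℂ} (hz : ‖z‖ ≤ 1) :
    Summable fun k => ‖c k * z ^ k‖ := by
  refine Summable.of_nonneg_of_le (fun _ => norm_nonneg _) (fun k => ?_) hc
  rw [norm_mul]
  exact mul_le_of_le_one_right (norm_nonneg _) (norm_pow_le_one hz k)

/-- Wiener's lemma for absolutely convergent power series on the closed unit disc. -/
theorem exists_summable_inverse {c : ℕ → ℂ} (hc : Summable fun k => ‖c k‖)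
    (h : ∀ z : ℂ, ‖z‖ ≤ 1 → chaosSymbol c z ≠ 0) :
    ∃ d : ℕ → ℂ, PowerSeries.mk c * PowerSeries.mk d = 1 ∧ Summable fun k => ‖d k‖ := by
  obtain ⟨d, hd⟩ := exists_mk_mul_eq_one (c := c) (by
    have := h 0 (by simp)
    rwa [chaosSymbol, tsum_eq_single 0 (fun k hk => by simp [hk]), pow_zero, mul_one] at this)
  refine ⟨d, hd, ?_⟩
  -- The closed algebra generated by the shift is a commutative Banach algebra, so a non-invertible
  -- element is killed by some character.
  let A := Algebra.elemental ℂ rightShift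
  let _ : NormedCommRing A := { (inferInstance : NormedRing A) with
    mul_comm := (inferInstance : CommRing A).mul_comm }
  have : Nontrivial (BoundedContinuousFunction ℕ ℂ) :=
    ⟨BoundedContinuousFunction.const ℕ 0, BoundedContinuousFunction.const ℕ 1, fun h => by
      simpa using DFunLike.congr_fun h 0⟩
  have : NormOneClass A := ⟨norm_one (α := BoundedContinuousFunction ℕ ℂ →L[ℂ]
    BoundedContinuousFunction ℕ ℂ)⟩
  let S : A := ⟨rightShift, Algebra.elemental.self_mem ℂ rightShift⟩
  have hS : ‖S‖ ≤ 1 := norm_rightShift_le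
  have hsum := summable_smul_pow hc hS
  have hunit : IsUnit (∑' i, c i • S ^ i) := by
    by_contra hnot
    obtain ⟨φ, hφ⟩ := WeakDual.CharacterSpace.exists_apply_eq_zero hnot
    -- A character sends ∑ c_i S^i to the symbol at φ(S), a point of the closed disc since ‖S‖ ≤ 1;
    -- vanishing there is excluded.
    refine h (φ S) ((AlgHom.norm_apply_le_self φ S).trans hS) ?_
    have h1 := (hsum.hasSum.map φ (map_continuous φ)).tsum_eq
    rw [hφ] at h1
    rw [chaosSymbol, ← h1]
    refine tsum_congr fun i => ?_
    simp
  obtain ⟨G, hG⟩ := hunit.exists_right_inv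
  let T : BoundedContinuousFunction ℕ ℂ →L[ℂ] BoundedContinuousFunction ℕ ℂ := G
  -- The inverse operator T is not known in advance to be a convolution; evaluating coordinates
  -- shows that c * (Tu) = u, and formal inversion then forces Tu = d * u.
  have hinv : ∀ u : BoundedContinuousFunction ℕ ℂ,
      PowerSeries.mk c * PowerSeries.mk (fun k => T u k) = PowerSeries.mk u := by
    intro u
    ext m
    let ev : A →L[ℂ] ℂ := ((BoundedContinuousFunction.evalCLM ℂ m).comp
      (ContinuousLinearMap.apply ℂ _ (T u))).comp A.toSubmodule.subtypeL
    have h1 : ev (∑' i, c i • S ^ i) = u m := by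
      have h2 : (((∑' i, c i • S ^ i) * G : A) : BoundedContinuousFunction ℕ ℂ →L[ℂ]
        BoundedContinuousFunction ℕ ℂ) u m = u m := by rw [hG]; rfl
      exact h2
    have h3 : ∀ i, ev (c i • S ^ i) = c i * if i ≤ m then T u (m - i) else 0 := fun i => by
      rw [← rightShift_pow_apply]
      rfl
    rw [PowerSeries.coeff_mk, ← h1, ev.map_tsum hsum]
    simp_rw [h3]
    rw [PowerSeries.coeff_mul, Finset.Nat.sum_antidiagonal_eq_sum_range_succ
      (fun i j => PowerSeries.coeff i (PowerSeries.mk c) *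
        PowerSeries.coeff j (PowerSeries.mk fun k => T u k)),
      tsum_eq_sum (s := Finset.range (m + 1))]
    · refine Finset.sum_congr rfl fun i hi => ?_
      rw [if_pos (by simp at hi; omega)]
      simp
    · intro i hi
      rw [if_neg (by simp at hi; omega), mul_zero]
  -- Convolution by d is now bounded on bounded sequences with constant ‖T‖, so duality gives
  -- summability.
  refine summable_norm_of_convolution_le (C := ‖T‖) fun x hx m => ?_
  let u := BoundedContinuousFunction.ofNormedAddCommGroupDiscrete x 1 hx
  have hu : ‖u‖ ≤ 1 := (BoundedContinuousFunction.norm_le zero_le_one).2 hx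
  have h1 : PowerSeries.mk (fun k => T u k) = PowerSeries.mk d * PowerSeries.mk x := by
    calc _ = PowerSeries.mk d * (PowerSeries.mk c * PowerSeries.mk (fun k => T u k)) := by
          rw [← mul_assoc, mul_comm (PowerSeries.mk d), hd, one_mul]
      _ = _ := by rw [hinv u]; rfl
  rw [← h1, PowerSeries.coeff_mk]
  calc _ ≤ ‖T u‖ := BoundedContinuousFunction.norm_coe_le_norm _ _
    _ ≤ ‖T‖ * ‖u‖ := ContinuousLinearMap.le_opNorm _ _
    _ ≤ ‖T‖ * 1 := by gcongr
    _ = ‖T‖ := mul_one _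

theorem chaosSymbol_ne_zero {c d : ℕ → ℂ} (hc : Summable fun k => ‖c k‖)
    (hd : Summable fun k => ‖d k‖) (h : PowerSeries.mk c * PowerSeries.mk d = 1) {z : ℂ}
    (hz : ‖z‖ ≤ 1) : chaosSymbol c z ≠ 0 := by
  have key : chaosSymbol c z * chaosSymbol d z = 1 := by
    unfold chaosSymbol
    rw [tsum_mul_tsum_eq_tsum_sum_antidiagonal_of_summable_norm (summable_symbol hc hz)
      (summable_symbol hd hz)]
    have : ∀ n, ∑ kl ∈ Finset.HasAntidiagonal.antidiagonal n, c kl.1 * z ^ kl.1 *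
        (d kl.2 * z ^ kl.2) = if n = 0 then 1 else 0 := fun n => by
      have h2 := congrArg (PowerSeries.coeff n) h
      rw [PowerSeries.coeff_mul, PowerSeries.coeff_one] at h2
      simp only [PowerSeries.coeff_mk] at h2
      calc _ = (∑ kl ∈ Finset.HasAntidiagonal.antidiagonal n, c kl.1 * d kl.2) * z ^ n := by
            rw [Finset.sum_mul]
            refine Finset.sum_congr rfl fun kl hkl => ?_
            rw [← Finset.HasAntidiagonal.mem_antidiagonal.1 hkl, pow_add]
            ring
        _ = _ := by rw [h2]; split_ifs with h0 <;> simp [h0]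
    simp_rw [this]
    simp
  intro h0
  rw [h0, zero_mul] at key
  exact zero_ne_one key

/-! ### Values on dyadic shells and bounded variation -/

theorem log_two_pow_add {k j : ℕ} (hj : j < 2 ^ k) : Nat.log 2 (2 ^ k + j) = k :=
  Nat.log_eq_of_pow_le_of_lt_pow (by omega) (by rw [pow_succ]; omega)

theorem affineTerm_eq_indicator (f : ℝ → ℂ) {k j : ℕ} (hj : j < 2 ^ k) :
    affineTerm f (2 ^ k + j) = Set.indicator (Set.Ioc ((j : ℝ) / 2 ^ k) (((j : ℝ) + 1) / 2 ^ k))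
      (fun t => f (2 ^ k * t - j)) := by
  classical
  ext t
  simp only [affineTerm, log_two_pow_add hj, Nat.add_sub_cancel_left, Set.indicator_apply]

theorem haarMother_of_mem_left {t : ℝ} (ht : t ∈ Set.Ioc (0 : ℝ) (1 / 2)) : haarMother t = 1 :=
  if_pos ht

theorem haarMother_of_mem_right {t : ℝ} (ht : t ∈ Set.Ioc (1 / 2 : ℝ) 1) : haarMother t = -1 := by
  rw [haarMother, if_neg (fun h => absurd h.2 (not_le.2 ht.1)), if_pos ht]

theorem haarFun_two_pow (k : ℕ) : haarFun (2 ^ k) = Set.indicator (Set.Ioc (0 : ℝ) (1 / 2 ^ k))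
    (fun t => haarMother (2 ^ k * t)) := by
  have := affineTerm_eq_indicator haarMother (k := k) (j := 0) (by positivity)
  simpa [haarFun] using this

theorem exists_mem_dyadic_shell {t : ℝ} (ht : t ∈ Set.Ioc (0 : ℝ) 1) :
    ∃ m : ℕ, t ∈ Set.Ioc (1 / 2 ^ (m + 1) : ℝ) (1 / 2 ^ m) := by
  obtain ⟨m, h1, h2⟩ := exists_nat_pow_near_of_lt_one ht.1 ht.2 (y := (1 / 2 : ℝ))
    (by norm_num) (by norm_num)
  exact ⟨m, by simpa using h1, by simpa using h2⟩

/-- The value of `∑ c_k h_{2^k}` on `(2^{-m-1}, 2^{-m}]`. -/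
def shellValue (c : ℕ → ℂ) (m : ℕ) : ℂ := ∑ i ∈ Finset.range m, c i - c m

theorem haarFun_two_pow_eq_zero {m i : ℕ} {t : ℝ}
    (ht : t ∈ Set.Ioc (1 / 2 ^ (m + 1) : ℝ) (1 / 2 ^ m)) (hi : m + 1 ≤ i) :
    haarFun (2 ^ i) t = 0 := by
  rw [haarFun_two_pow, Set.indicator_of_notMem]
  rintro ⟨-, h3⟩
  have h4 : (1 / 2 ^ i : ℝ) ≤ 1 / 2 ^ (m + 1) :=
    one_div_le_one_div_of_le (by positivity) (pow_le_pow_right₀ (by norm_num) hi)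
  linarith [ht.1]

/-- On this shell h_{2^i} equals 1 for i < m, -1 for i = m and 0 for i > m. -/
theorem firstChaos_apply (c : ℕ → ℂ) {m : ℕ} {t : ℝ}
    (ht : t ∈ Set.Ioc (1 / 2 ^ (m + 1) : ℝ) (1 / 2 ^ m)) : firstChaos c t = shellValue c m := by
  have ht0 : 0 < t := lt_trans (by positivity) ht.1
  have h1 : 1 / 2 < 2 ^ m * t := by
    have := (div_lt_iff₀ (by positivity)).1 ht.1
    rw [pow_succ] at this; linarith
  have h2 : 2 ^ m * t ≤ 1 := by
    have := (le_div_iff₀ (by positivity)).1 ht.2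
    linarith
  rw [firstChaos, tsum_eq_sum (s := Finset.range (m + 1)), Finset.sum_range_succ, shellValue,
    sub_eq_add_neg]
  · congr 1
    · refine Finset.sum_congr rfl fun i hi => ?_
      have hi' : i + 1 ≤ m := by simpa using hi
      have h3 : (2 : ℝ) ^ (i + 1) ≤ 2 ^ m := pow_le_pow_right₀ (by norm_num) hi'
      have h4 : 2 ^ i * t ≤ 1 / 2 := by rw [pow_succ] at h3; nlinarith
      have h5 : t ∈ Set.Ioc (0 : ℝ) (1 / 2 ^ i) :=
        ⟨ht0, by rw [le_div_iff₀ (by positivity)]; linarith⟩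
      rw [haarFun_two_pow, Set.indicator_of_mem h5,
        haarMother_of_mem_left (t := 2 ^ i * t) ⟨by positivity, h4⟩,
        mul_one]
    · have h3 : t ∈ Set.Ioc (0 : ℝ) (1 / 2 ^ m) := ⟨ht0, ht.2⟩
      rw [haarFun_two_pow, Set.indicator_of_mem h3,
        haarMother_of_mem_right (t := 2 ^ m * t) ⟨h1, h2⟩]
      ring
  · intro i hi
    have hi' : m + 1 ≤ i := by simpa using hi
    rw [haarFun_two_pow_eq_zero ht hi', mul_zero]

theorem firstChaos_of_half_lt (c : ℕ → ℂ) {t : ℝ} (ht : t ∈ Set.Ioc (1 / 2 : ℝ) 1) :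
    firstChaos c t = -c 0 := by
  rw [firstChaos_apply c (m := 0) (by simpa using ht)]
  simp [shellValue]

/-- Self-similarity: on the left half, the chaos is a constant plus a rescaled chaos with shifted
coefficients. The induction computing its Haar coefficients rests on this. -/
theorem firstChaos_div_two (c : ℕ → ℂ) {t : ℝ} (ht : t ∈ Set.Ioc (0 : ℝ) 1) :
    firstChaos c (t / 2) = c 0 + firstChaos (fun k => c (k + 1)) t := by
  obtain ⟨m, hm⟩ := exists_mem_dyadic_shell ht
  rw [firstChaos_apply _ hm, firstChaos_apply c (m := m + 1)]
  · simp only [shellValue]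
    rw [Finset.sum_range_succ']
    ring
  · constructor
    · have := hm.1
      rw [pow_succ, ← div_div]; linarith
    · have := hm.2
      rw [pow_succ, ← div_div]; linarith

theorem edist_le_sum_Ico {u : ℕ → ℂ} {m n : ℕ} (h : m ≤ n) :
    edist (u n) (u m) ≤ ∑ k ∈ Finset.Ico m n, edist (u (k + 1)) (u k) := by
  rw [edist_comm]
  refine (edist_le_Ico_sum_edist u h).trans (Finset.sum_le_sum fun k _ => (edist_comm _ _).le)

theorem eVariationOn_univ_nat (u : ℕ → ℂ) :
    eVariationOn u Set.univ = ∑' k, edist (u (k + 1)) (u k) := by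
  apply le_antisymm
  · refine iSup_le fun p => ?_
    have hmono : Monotone p.2.1 := p.2.2.1
    have key : ∀ n, ∑ i ∈ Finset.range n, edist (u (p.2.1 (i + 1))) (u (p.2.1 i)) ≤
        ∑ k ∈ Finset.Ico (p.2.1 0) (p.2.1 n), edist (u (k + 1)) (u k) := fun n => by
      induction n with
      | zero => simp
      | succ n ih =>
        rw [Finset.sum_range_succ, ← Finset.sum_Ico_consecutive _ (hmono (Nat.zero_le n))
          (hmono (Nat.le_succ n))]
        exact add_le_add ih (edist_le_sum_Ico (hmono (Nat.le_succ n)))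
    exact (key p.1).trans (ENNReal.sum_le_tsum _)
  · rw [ENNReal.tsum_eq_iSup_nat]
    exact iSup_le fun n => eVariationOn.sum_le (u := fun i => i) monotone_id fun _ => Set.mem_univ _

/-- The function factors through the shell index, which is antitone in t, and conversely the shell
values are recovered at the points 2^{-i}. Composition with antitone maps bounds the variation both
ways. -/
theorem eVariationOn_firstChaos {c : ℕ → ℂ} {f : ℝ → ℂ}
    (hf : ∀ t ∈ Set.Ioc (0 : ℝ) 1, f t = firstChaos c t) :
    eVariationOn f (Set.Ioc 0 1) = ∑' k, edist (shellValue c (k + 1)) (shellValue c k) := by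
  rw [← eVariationOn_univ_nat]
  have hpt : ∀ i : ℕ, (1 / 2 ^ i : ℝ) ∈ Set.Ioc (0 : ℝ) 1 := fun i =>
    ⟨by positivity, by
      rw [div_le_one (by positivity)]; exact one_le_pow₀ (by norm_num)⟩
  have hanti : ∀ {i j : ℕ}, i ≤ j → (1 / 2 ^ j : ℝ) ≤ 1 / 2 ^ i := fun h =>
    one_div_le_one_div_of_le (by positivity) (pow_le_pow_right₀ (by norm_num) h)
  apply le_antisymm
  · have hch : ∀ t : ℝ, ∃ m : ℕ, t ∈ Set.Ioc (0 : ℝ) 1 →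
        t ∈ Set.Ioc (1 / 2 ^ (m + 1) : ℝ) (1 / 2 ^ m) := fun t => by
      by_cases ht : t ∈ Set.Ioc (0 : ℝ) 1
      · exact (exists_mem_dyadic_shell ht).imp fun m hm _ => hm
      · exact ⟨0, fun h => absurd h ht⟩
    choose p hp using hch
    have heq : Set.EqOn f (shellValue c ∘ p) (Set.Ioc 0 1) := fun t ht => by
      rw [hf t ht, firstChaos_apply c (hp t ht)]; rfl
    rw [eVariationOn.eq_of_eqOn heq]
    refine eVariationOn.comp_le_of_antitoneOn _ _ ?_ fun _ _ => Set.mem_univ _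
    intro s hs t ht hst
    by_contra hlt
    have h1 := hanti (show p s + 1 ≤ p t by omega)
    linarith [(hp s hs).1, (hp t ht).2]
  · have heq : shellValue c = f ∘ fun i : ℕ => (1 / 2 ^ i : ℝ) := by
      ext i
      rw [Function.comp, hf _ (hpt i), firstChaos_apply c (m := i)]
      refine ⟨?_, le_rfl⟩
      exact one_div_lt_one_div_of_lt (by positivity) (pow_lt_pow_right₀ (by norm_num) (by omega))
    rw [heq]
    exact eVariationOn.comp_le_of_antitoneOn _ _ (fun i _ j _ h => hanti h) fun i _ => hpt i

theorem edist_shellValue (c : ℕ → ℂ) (k : ℕ) :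
    edist (shellValue c (k + 1)) (shellValue c k) = ‖2 * c k - c (k + 1)‖ₑ := by
  rw [edist_eq_enorm_sub]
  congr 1
  simp only [shellValue, Finset.sum_range_succ]
  ring

theorem tsum_enorm_ne_top_iff {c : ℕ → ℂ} : ∑' i, ‖c i‖ₑ ≠ ∞ ↔ Summable fun k => ‖c k‖ := by
  simp_rw [enorm_eq_nnnorm]
  rw [ENNReal.tsum_coe_ne_top_iff_summable, ← NNReal.summable_coe]
  rfl

theorem boundedVariationOn_of_summable {c : ℕ → ℂ} {f : ℝ → ℂ}
    (hf : ∀ t ∈ Set.Ioc (0 : ℝ) 1, f t = firstChaos c t) (hc : Summable fun k => ‖c k‖) :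
    BoundedVariationOn f (Set.Ioc 0 1) := by
  rw [BoundedVariationOn, eVariationOn_firstChaos hf]
  simp_rw [edist_shellValue]
  rw [tsum_enorm_ne_top_iff (c := fun k => 2 * c k - c (k + 1))]
  refine Summable.of_nonneg_of_le (fun _ => norm_nonneg _) (fun k => norm_sub_le _ _) ?_
  refine Summable.add ?_ ((summable_nat_add_iff 1).2 hc)
  simpa using hc.mul_left 2

/-- From 2|c_k| ≤ |2c_k - c_{k+1}| + |c_{k+1}| one telescopes to ∑_{k<n} |c_k| ≤ |c_n| +
(variation). The bound M is essential: c_k = 2^k gives the constant function -1. -/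
theorem summable_of_boundedVariationOn {c : ℕ → ℂ} {f : ℝ → ℂ}
    (hf : ∀ t ∈ Set.Ioc (0 : ℝ) 1, f t = firstChaos c t)
    (h : BoundedVariationOn f (Set.Ioc 0 1)) {M : ℝ} (hM : ∀ k, ‖c k‖ ≤ M) :
    Summable fun k => ‖c k‖ := by
  rw [BoundedVariationOn, eVariationOn_firstChaos hf] at h
  simp_rw [edist_shellValue] at h
  rw [tsum_enorm_ne_top_iff (c := fun k => 2 * c k - c (k + 1))] at h
  have h1 : ∀ n, ∑ k ∈ Finset.range n, ‖c k‖ ≤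
      ‖c n‖ + ∑ k ∈ Finset.range n, ‖2 * c k - c (k + 1)‖ := fun n => by
    have key : ∀ k, 2 * ‖c k‖ ≤ ‖2 * c k - c (k + 1)‖ + ‖c (k + 1)‖ := fun k => by
      calc 2 * ‖c k‖ = ‖(2 * c k - c (k + 1)) + c (k + 1)‖ := by simp
        _ ≤ _ := norm_add_le _ _
    induction n with
    | zero => simp
    | succ n ih =>
      rw [Finset.sum_range_succ, Finset.sum_range_succ]
      linarith [key n]
  refine summable_of_sum_range_le (c := M + ∑' k, ‖2 * c k - c (k + 1)‖) (fun _ => norm_nonneg _)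
    fun n => (h1 n).trans (add_le_add (hM n) ?_)
  exact h.sum_le_tsum _ fun _ _ => norm_nonneg _

/-! ### Dyadic rescaling of functions and of Haar coefficients -/

instance instIsProbabilityMeasureUnitMeasure : IsProbabilityMeasure unitMeasure :=
  ⟨by simp [unitMeasure]⟩

/-- The increasing affine bijection of `(0,1]` onto the dyadic interval `(j/2^k, (j+1)/2^k]`. -/
def dyadicMap (k j : ℕ) (t : ℝ) : ℝ := ((j : ℝ) + t) / 2 ^ k

theorem measurableEmbedding_dyadicMap (k j : ℕ) : MeasurableEmbedding (dyadicMap k j) := by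
  have h1 : MeasurableEmbedding fun t : ℝ => (j : ℝ) + t := measurableEmbedding_addLeft _
  have h2 : MeasurableEmbedding fun t : ℝ => t * ((2 : ℝ) ^ k)⁻¹ :=
    measurableEmbedding_mulRight₀ (by positivity)
  have := h2.comp h1
  convert this using 1
  ext t
  simp [dyadicMap, div_eq_mul_inv]

theorem dyadicMap_preimage (k j : ℕ) :
    dyadicMap k j ⁻¹' Set.Ioc ((j : ℝ) / 2 ^ k) (((j : ℝ) + 1) / 2 ^ k) = Set.Ioc 0 1 := by
  ext t
  simp only [dyadicMap, Set.mem_preimage, Set.mem_Ioc]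
  rw [div_lt_div_iff_of_pos_right (by positivity), div_le_div_iff_of_pos_right (by positivity)]
  constructor <;> rintro ⟨h1, h2⟩ <;> constructor <;> linarith

theorem map_dyadicMap_volume (k j : ℕ) :
    Measure.map (dyadicMap k j) volume = (2 ^ k : ℝ≥0∞) • (volume : Measure ℝ) := by
  have h1 : Measure.map (fun t : ℝ => (j : ℝ) + t) volume = volume := by
    simpa using map_add_left_eq_self (volume : Measure ℝ) (j : ℝ)
  have h2 := Real.map_volume_mul_right (a := ((2 : ℝ) ^ k)⁻¹) (by positivity)
  have h3 : dyadicMap k j = (fun t : ℝ => t * ((2 : ℝ) ^ k)⁻¹) ∘ fun t : ℝ => (j : ℝ) + t := by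
    ext t; simp [dyadicMap, div_eq_mul_inv]
  rw [h3, ← Measure.map_map (by fun_prop) (by fun_prop), h1, h2, inv_inv,
    abs_of_pos (by positivity),
    ENNReal.ofReal_pow (by norm_num)]
  simp

theorem map_dyadicMap (k j : ℕ) : Measure.map (dyadicMap k j) unitMeasure =
    (2 ^ k : ℝ≥0∞) • volume.restrict (Set.Ioc ((j : ℝ) / 2 ^ k) (((j : ℝ) + 1) / 2 ^ k)) := by
  rw [unitMeasure, ← dyadicMap_preimage k j, ← (measurableEmbedding_dyadicMap k j).restrict_map,
    map_dyadicMap_volume, Measure.restrict_smul]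

theorem dyadic_Ioc_subset {k j : ℕ} (hj : j < 2 ^ k) :
    Set.Ioc ((j : ℝ) / 2 ^ k) (((j : ℝ) + 1) / 2 ^ k) ⊆ Set.Ioc 0 1 := by
  have : (j : ℝ) + 1 ≤ 2 ^ k := by exact_mod_cast hj
  refine Set.Ioc_subset_Ioc (by positivity) ?_
  rw [div_le_one (by positivity)]
  exact this

theorem integral_comp_dyadicMap (x : ℝ → ℂ) (k j : ℕ) : ∫ t, x (dyadicMap k j t) ∂unitMeasure =
    2 ^ k * ∫ t in Set.Ioc ((j : ℝ) / 2 ^ k) (((j : ℝ) + 1) / 2 ^ k), x t := by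
  rw [← (measurableEmbedding_dyadicMap k j).integral_map, map_dyadicMap, integral_smul_measure]
  simp

theorem map_dyadicMap_le {k j : ℕ} (hj : j < 2 ^ k) :
    Measure.map (dyadicMap k j) unitMeasure ≤ (2 ^ k : ℝ≥0∞) • unitMeasure := by
  rw [map_dyadicMap]
  gcongr
  exact Measure.restrict_mono (dyadic_Ioc_subset hj) le_rfl

theorem memLp_comp_dyadicMap {x : ℝ → ℂ} {p : ℝ≥0∞} (hx : MemLp x p unitMeasure) {k j : ℕ}
    (hj : j < 2 ^ k) : MemLp (fun t => x (dyadicMap k j t)) p unitMeasure := by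
  refine MemLp.comp_of_map (f := dyadicMap k j) ?_
    (measurableEmbedding_dyadicMap k j).measurable.aemeasurable
  exact (hx.smul_measure (by finiteness)).mono_measure (map_dyadicMap_le hj)

theorem dyadicMap_mem {k j : ℕ} (hj : j < 2 ^ k) {t : ℝ} (ht : t ∈ Set.Ioc (0 : ℝ) 1) :
    dyadicMap k j t ∈ Set.Ioc (0 : ℝ) 1 := by
  rw [← dyadicMap_preimage k j] at ht
  exact dyadic_Ioc_subset hj ht

theorem ae_unitMeasure_of_forall {p : ℝ → Prop} (h : ∀ t ∈ Set.Ioc (0 : ℝ) 1, p t) :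
    ∀ᵐ t ∂unitMeasure, p t :=
  (ae_restrict_iff' measurableSet_Ioc).2 (Eventually.of_forall h)

theorem integral_unitMeasure_congr {x y : ℝ → ℂ} (h : ∀ t ∈ Set.Ioc (0 : ℝ) 1, x t = y t) :
    ∫ t, x t ∂unitMeasure = ∫ t, y t ∂unitMeasure :=
  integral_congr_ae (ae_unitMeasure_of_forall h)

theorem child_lt {k j l r : ℕ} (hj : j < 2 ^ k) (hr : r < 2 ^ l) : 2 ^ l * j + r < 2 ^ (l + k) := by
  calc 2 ^ l * j + r < 2 ^ l * (j + 1) := by rw [mul_add]; omega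
    _ ≤ 2 ^ l * 2 ^ k := Nat.mul_le_mul_left _ hj
    _ = _ := by rw [pow_add]

theorem child_eq (k j l r : ℕ) : 2 ^ l * (2 ^ k + j) + r = 2 ^ (l + k) + (2 ^ l * j + r) := by
  rw [pow_add]; ring

/-- The index 2^l(2^k + j) + r is the r-th descendant, l levels down, of the node 2^k + j; rescaling
its interval to (0,1] carries the subtree onto the whole tree. -/
theorem affineTerm_dyadicMap (f : ℝ → ℂ) {k j l r : ℕ} (hj : j < 2 ^ k) (hr : r < 2 ^ l) (t : ℝ) :
    affineTerm f (2 ^ l * (2 ^ k + j) + r) (dyadicMap k j t) = affineTerm f (2 ^ l + r) t := by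
  have hk : (0 : ℝ) < 2 ^ k := by positivity
  have hl : (0 : ℝ) < 2 ^ l := by positivity
  rw [child_eq, affineTerm_eq_indicator f (child_lt hj hr), affineTerm_eq_indicator f hr]
  have hmem : dyadicMap k j t ∈ Set.Ioc (((2 ^ l * j + r : ℕ) : ℝ) / 2 ^ (l + k))
      ((((2 ^ l * j + r : ℕ) : ℝ) + 1) / 2 ^ (l + k)) ↔
      t ∈ Set.Ioc ((r : ℝ) / 2 ^ l) (((r : ℝ) + 1) / 2 ^ l) := by
    simp only [dyadicMap, Set.mem_Ioc]
    rw [pow_add, div_lt_div_iff₀ (by positivity) hk, div_le_div_iff₀ hk (by positivity),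
      div_lt_iff₀ hl, le_div_iff₀ hl]
    push_cast
    rw [show ((j : ℝ) + t) * (2 ^ l * 2 ^ k) = (2 ^ l * (j + t)) * 2 ^ k by ring,
      mul_lt_mul_iff_left₀ hk, mul_le_mul_iff_left₀ hk]
    constructor <;> rintro ⟨h1, h2⟩ <;> constructor <;> nlinarith
  by_cases h : t ∈ Set.Ioc ((r : ℝ) / 2 ^ l) (((r : ℝ) + 1) / 2 ^ l)
  · rw [Set.indicator_of_mem h, Set.indicator_of_mem (hmem.2 h)]
    congr 1
    simp only [dyadicMap]
    push_cast
    rw [pow_add]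
    field_simp
    ring
  · rw [Set.indicator_of_notMem h, Set.indicator_of_notMem (fun h' => h (hmem.1 h'))]

theorem affineTerm_eq_zero_of_notMem (f : ℝ → ℂ) {k j l r : ℕ} (hj : j < 2 ^ k) (hr : r < 2 ^ l)
    {t : ℝ} (ht : t ∉ Set.Ioc ((j : ℝ) / 2 ^ k) (((j : ℝ) + 1) / 2 ^ k)) :
    affineTerm f (2 ^ l * (2 ^ k + j) + r) t = 0 := by
  obtain ⟨s, rfl⟩ : ∃ s, dyadicMap k j s = t := ⟨2 ^ k * t - j, by simp [dyadicMap]⟩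
  rw [affineTerm_dyadicMap f hj hr, affineTerm_eq_indicator f hr, Set.indicator_of_notMem]
  intro h
  have := dyadic_Ioc_subset hr h
  rw [← dyadicMap_preimage k j] at this
  exact ht this

/-- Integration against a function supported in a dyadic interval. -/
theorem integral_eq_of_support {y : ℝ → ℂ} {k j : ℕ} (hj : j < 2 ^ k)
    (hy : ∀ t, t ∉ Set.Ioc ((j : ℝ) / 2 ^ k) (((j : ℝ) + 1) / 2 ^ k) → y t = 0) :
    2 ^ k * ∫ t, y t ∂unitMeasure = ∫ t, y (dyadicMap k j t) ∂unitMeasure := by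
  rw [integral_comp_dyadicMap, unitMeasure]
  congr 1
  exact setIntegral_eq_of_subset_of_forall_sdiff_eq_zero measurableSet_Ioc (dyadic_Ioc_subset hj)
    fun t ht => hy t ht.2

/-- The factor 2^k in the definition of the coefficient exactly compensates the change of scale, so
coefficients are merely reindexed. -/
theorem haarCoeff_comp_dyadicMap (x : ℝ → ℂ) {k j l r : ℕ} (hj : j < 2 ^ k) (hr : r < 2 ^ l) :
    haarCoeff (fun t => x (dyadicMap k j t)) (2 ^ l + r) =
      haarCoeff x (2 ^ l * (2 ^ k + j) + r) := by
  rw [haarCoeff, haarCoeff, log_two_pow_add hr, child_eq, log_two_pow_add (child_lt hj hr),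
    ← child_eq, pow_add, mul_assoc, integral_eq_of_support hj]
  · congr 1
    refine integral_congr_ae (Eventually.of_forall fun t => ?_)
    simp only [haarFun]
    rw [affineTerm_dyadicMap _ hj hr]
  · intro t ht
    rw [haarFun, affineTerm_eq_zero_of_notMem _ hj hr ht, mul_zero]

theorem integral_eq_half_add {x : ℝ → ℂ} (hx : Integrable x unitMeasure) :
    ∫ t, x t ∂unitMeasure = ((∫ t, x (dyadicMap 1 0 t) ∂unitMeasure) +
      ∫ t, x (dyadicMap 1 1 t) ∂unitMeasure) / 2 := by
  rw [integral_comp_dyadicMap, integral_comp_dyadicMap]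
  have h1 : Set.Ioc (0 : ℝ) 1 = Set.Ioc 0 (1 / 2) ∪ Set.Ioc (1 / 2) 1 :=
    (Set.Ioc_union_Ioc_eq_Ioc (by norm_num) (by norm_num)).symm
  unfold unitMeasure at hx ⊢
  have hx' : IntegrableOn x (Set.Ioc 0 1) := hx
  rw [h1] at hx'
  rw [h1, setIntegral_union (Set.Ioc_disjoint_Ioc_of_le le_rfl) measurableSet_Ioc hx'.left_of_union
    hx'.right_of_union]
  norm_num
  ring

theorem dyadicMap_one_zero_mem {t : ℝ} (ht : t ∈ Set.Ioc (0 : ℝ) 1) :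
    dyadicMap 1 0 t ∈ Set.Ioc (0 : ℝ) (1 / 2) := by
  obtain ⟨h1, h2⟩ := ht
  constructor <;> simp [dyadicMap] <;> linarith

theorem dyadicMap_one_one_mem {t : ℝ} (ht : t ∈ Set.Ioc (0 : ℝ) 1) :
    dyadicMap 1 1 t ∈ Set.Ioc (1 / 2 : ℝ) 1 := by
  obtain ⟨h1, h2⟩ := ht
  constructor <;> simp [dyadicMap] <;> linarith

theorem measurable_haarMother : Measurable haarMother := by
  classical
  exact Measurable.ite measurableSet_Ioc measurable_const
    (Measurable.ite measurableSet_Ioc measurable_const measurable_const)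

theorem norm_haarMother_le (t : ℝ) : ‖haarMother t‖ ≤ 1 := by
  unfold haarMother
  split_ifs <;> simp

theorem haarFun_one_of_mem {t : ℝ} (ht : t ∈ Set.Ioc (0 : ℝ) 1) : haarFun 1 t = haarMother t := by
  have := affineTerm_eq_indicator haarMother (k := 0) (j := 0) (by norm_num)
  simp only [pow_zero, add_zero] at this
  rw [haarFun, this, Set.indicator_of_mem (by simpa using ht)]
  simp

theorem exists_level {n : ℕ} (hn : 1 ≤ n) : ∃ k j, j < 2 ^ k ∧ n = 2 ^ k + j := by
  refine ⟨Nat.log 2 n, n - 2 ^ Nat.log 2 n, ?_, ?_⟩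
  · have := Nat.lt_pow_succ_log_self one_lt_two n
    rw [pow_succ] at this; omega
  · have := Nat.pow_log_le_self 2 (show n ≠ 0 by omega)
    omega

theorem measurable_haarFun {n : ℕ} (hn : 1 ≤ n) : Measurable (haarFun n) := by
  obtain ⟨k, j, hj, rfl⟩ := exists_level hn
  rw [haarFun, affineTerm_eq_indicator _ hj]
  refine Measurable.indicator (measurable_haarMother.comp (by fun_prop)) measurableSet_Ioc

theorem norm_haarFun_le {n : ℕ} (hn : 1 ≤ n) (t : ℝ) : ‖haarFun n t‖ ≤ 1 := by
  obtain ⟨k, j, hj, rfl⟩ := exists_level hn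
  rw [haarFun, affineTerm_eq_indicator _ hj]
  exact (norm_indicator_le_norm_self _ _).trans (norm_haarMother_le _)

theorem memLp_haarFun {n : ℕ} (hn : 1 ≤ n) (p : ℝ≥0∞) : MemLp (haarFun n) p unitMeasure :=
  MemLp.of_bound (measurable_haarFun hn).aestronglyMeasurable 1
    (Eventually.of_forall (norm_haarFun_le hn))

theorem integrable_mul_haarFun {x : ℝ → ℂ} (hx : Integrable x unitMeasure) {n : ℕ} (hn : 1 ≤ n) :
    Integrable (fun t => x t * haarFun n t) unitMeasure :=
  hx.mul_bdd (c := 1) (measurable_haarFun hn).aestronglyMeasurable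
    (Eventually.of_forall (norm_haarFun_le hn))

/-- Half the difference of the means on the two halves. With `integral_eq_half_add`, the mean and
this coefficient determine both half means. -/
theorem haarCoeff_one {x : ℝ → ℂ} (hx : Integrable x unitMeasure) :
    haarCoeff x 1 = ((∫ t, x (dyadicMap 1 0 t) ∂unitMeasure) -
      ∫ t, x (dyadicMap 1 1 t) ∂unitMeasure) / 2 := by
  rw [haarCoeff, integral_eq_half_add (integrable_mul_haarFun hx le_rfl),
    integral_unitMeasure_congr (x := fun t => x (dyadicMap 1 0 t) * haarFun 1 (dyadicMap 1 0 t))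
      (y := fun t => x (dyadicMap 1 0 t)),
    integral_unitMeasure_congr (x := fun t => x (dyadicMap 1 1 t) * haarFun 1 (dyadicMap 1 1 t))
      (y := fun t => -x (dyadicMap 1 1 t)), integral_neg]
  · simp [sub_eq_add_neg]
  · intro t ht
    rw [haarFun_one_of_mem (dyadicMap_mem (by norm_num) ht),
      haarMother_of_mem_right (dyadicMap_one_one_mem ht), mul_neg_one]
  · intro t ht
    rw [haarFun_one_of_mem (dyadicMap_mem (by norm_num) ht),
      haarMother_of_mem_left (dyadicMap_one_zero_mem ht), mul_one]

theorem haarCoeff_congr {x y : ℝ → ℂ} (h : ∀ t ∈ Set.Ioc (0 : ℝ) 1, x t = y t) (n : ℕ) :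
    haarCoeff x n = haarCoeff y n := by
  rw [haarCoeff, haarCoeff, integral_unitMeasure_congr fun t ht => by rw [h t ht]]

theorem haarCoeff_const_smul (a : ℂ) (x : ℝ → ℂ) (n : ℕ) :
    haarCoeff (a • x) n = a * haarCoeff x n := by
  rw [haarCoeff, haarCoeff, mul_left_comm]
  congr 1
  rw [← integral_const_mul]
  simp only [Pi.smul_apply, smul_eq_mul, mul_assoc]

theorem haarCoeff_sub {x y : ℝ → ℂ} (hx : Integrable x unitMeasure) (hy : Integrable y unitMeasure)
    {n : ℕ} (hn : 1 ≤ n) : haarCoeff (x - y) n = haarCoeff x n - haarCoeff y n := by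
  rw [haarCoeff, haarCoeff, haarCoeff, ← mul_sub, ← integral_sub (integrable_mul_haarFun hx hn)
    (integrable_mul_haarFun hy hn)]
  simp [sub_mul]

theorem haarCoeff_sum {ι : Type*} (F : Finset ι) {x : ι → ℝ → ℂ}
    (hx : ∀ i ∈ F, Integrable (x i) unitMeasure) {n : ℕ} (hn : 1 ≤ n) :
    haarCoeff (∑ i ∈ F, x i) n = ∑ i ∈ F, haarCoeff (x i) n := by
  simp only [haarCoeff]
  rw [← Finset.mul_sum, ← integral_finsetSum _ fun i hi => integrable_mul_haarFun (hx i hi) hn]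
  simp [Finset.sum_mul]

theorem haarCoeff_const (a : ℂ) {n : ℕ} (hn : 1 ≤ n) : haarCoeff (fun _ => a) n = 0 := by
  obtain ⟨k, j, hj, rfl⟩ := exists_level hn
  have := haarCoeff_comp_dyadicMap (fun _ => a) (l := 0) (r := 0) hj (by norm_num)
  simp only [pow_zero, one_mul, add_zero] at this
  rw [← this, haarCoeff_one (integrable_const a)]
  simp

theorem haarCoeff_eq_comp (x : ℝ → ℂ) {k j : ℕ} (hj : j < 2 ^ k) :
    haarCoeff x (2 ^ k + j) = haarCoeff (fun t => x (dyadicMap k j t)) 1 := by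
  have := haarCoeff_comp_dyadicMap x (l := 0) (r := 0) hj (by norm_num)
  simpa using this.symm

/-! ### Haar coefficients of a first-order chaos and of its dilations -/

theorem integral_dyadicMap_firstChaos {c : ℕ → ℂ} {f : ℝ → ℂ}
    (hf : ∀ t ∈ Set.Ioc (0 : ℝ) 1, f t = firstChaos c t) (hint : Integrable f unitMeasure)
    (h0 : ∫ t, f t ∂unitMeasure = 0) : ∫ t, f (dyadicMap 1 0 t) ∂unitMeasure = c 0 ∧
      ∫ t, f (dyadicMap 1 1 t) ∂unitMeasure = -c 0 := by
  have h1 : ∫ t, f (dyadicMap 1 1 t) ∂unitMeasure = -c 0 := by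
    rw [integral_unitMeasure_congr (y := fun _ => -c 0)]
    · simp
    · intro t ht
      rw [hf _ (dyadicMap_mem (by norm_num) ht), firstChaos_of_half_lt _ (dyadicMap_one_one_mem ht)]
  refine ⟨?_, h1⟩
  -- Mean zero enters here: the value -c_0 on the right half must be balanced by mean c_0 on the
  -- left half.
  rw [integral_eq_half_add hint, h1] at h0
  linear_combination 2 * h0

/-- The Haar coefficients of a first-order chaos. -/
theorem haarCoeff_firstChaos_two_pow (k : ℕ) {c : ℕ → ℂ} {f : ℝ → ℂ}
    (hf : ∀ t ∈ Set.Ioc (0 : ℝ) 1, f t = firstChaos c t) (hint : Integrable f unitMeasure)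
    (h0 : ∫ t, f t ∂unitMeasure = 0) : haarCoeff f (2 ^ k) = c k := by
  obtain ⟨h2, h1⟩ := integral_dyadicMap_firstChaos hf hint h0
  induction k generalizing c f with
  | zero => rw [pow_zero, haarCoeff_one hint, h1, h2]; ring
  | succ k ih =>
    have h3 := haarCoeff_comp_dyadicMap f (k := 1) (j := 0) (l := k) (r := 0) (by norm_num)
      (by positivity)
    have hint' : Integrable (fun t => f (dyadicMap 1 0 t)) unitMeasure :=
      memLp_one_iff_integrable.1
        (memLp_comp_dyadicMap (memLp_one_iff_integrable.2 hint) (by norm_num))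
    -- The restriction to the left half minus its mean c_0 is again a mean zero chaos, with
    -- coefficients shifted by one.
    obtain ⟨g, hg⟩ : ∃ g : ℝ → ℂ, g = (fun t => f (dyadicMap 1 0 t)) - fun _ => c 0 := ⟨_, rfl⟩
    have hg1 : ∀ t ∈ Set.Ioc (0 : ℝ) 1, g t = firstChaos (fun k => c (k + 1)) t := fun t ht => by
      have := firstChaos_div_two c ht
      rw [hg, Pi.sub_apply, hf _ (dyadicMap_mem (by norm_num) ht), dyadicMap]
      simp [this]
    have hgint : Integrable g unitMeasure := hg ▸ hint'.sub (integrable_const _)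
    have hg0 : ∫ t, g t ∂unitMeasure = 0 := by
      simp only [hg, Pi.sub_apply]
      rw [integral_sub hint' (integrable_const _), h2]
      simp
    obtain ⟨h5, h6⟩ := integral_dyadicMap_firstChaos hg1 hgint hg0
    have h4 := ih hg1 hgint hg0 h5 h6
    rw [hg, haarCoeff_sub hint' (integrable_const _) Nat.one_le_two_pow,
      haarCoeff_const _ Nat.one_le_two_pow, sub_zero] at h4
    rw [← h4]
    simp only [add_zero, pow_one] at h3
    rw [h3, pow_succ]

/-- A dyadic interval not touching 0 lies inside a single shell, where the chaos is constant. -/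
theorem haarCoeff_firstChaos_of_pos {c : ℕ → ℂ} {f : ℝ → ℂ}
    (hf : ∀ t ∈ Set.Ioc (0 : ℝ) 1, f t = firstChaos c t) {k j : ℕ} (hj : j < 2 ^ k) (hj0 : 1 ≤ j) :
    haarCoeff f (2 ^ k + j) = 0 := by
  obtain ⟨a, i, hi, rfl⟩ := exists_level hj0
  have hak : a < k := (Nat.pow_lt_pow_iff_right one_lt_two).1 (by omega : 2 ^ a < 2 ^ k)
  -- With 2^a ≤ j < 2^{a+1} and k = a + 1 + p, the interval lies in the shell (2^{-p-1}, 2^{-p}].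
  obtain ⟨p, rfl⟩ : ∃ p, k = a + 1 + p := ⟨k - (a + 1), by omega⟩
  rw [haarCoeff_eq_comp _ hj, haarCoeff_congr (y := fun _ => shellValue c p),
    haarCoeff_const _ le_rfl]
  intro t ht
  rw [hf _ (dyadicMap_mem hj ht), firstChaos_apply c (m := p)]
  have hi' : (i : ℝ) + 1 ≤ 2 ^ a := by exact_mod_cast hi
  have hi0 : (0 : ℝ) ≤ i := by positivity
  simp only [dyadicMap, Set.mem_Ioc]
  obtain ⟨h1, h2⟩ := ht
  push_cast
  constructor
  · rw [div_lt_div_iff₀ (by positivity) (by positivity), one_mul,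
      show (2 : ℝ) ^ (a + 1 + p) = 2 ^ a * 2 ^ (p + 1) by ring]
    gcongr
    linarith
  · rw [div_le_div_iff₀ (by positivity) (by positivity), one_mul,
      show (2 : ℝ) ^ (a + 1 + p) = (2 * 2 ^ a) * 2 ^ p by ring]
    gcongr
    linarith

theorem dyadic_Ioc_unique {k i j : ℕ} {t : ℝ}
    (hi : t ∈ Set.Ioc ((i : ℝ) / 2 ^ k) (((i : ℝ) + 1) / 2 ^ k))
    (hj : t ∈ Set.Ioc ((j : ℝ) / 2 ^ k) (((j : ℝ) + 1) / 2 ^ k)) : i = j := by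
  have key : ∀ {a b : ℕ}, (a : ℝ) / 2 ^ k < t → t ≤ ((b : ℝ) + 1) / 2 ^ k → a ≤ b := by
    intro a b h1 h2
    have h3 := h1.trans_le h2
    rw [div_lt_div_iff_of_pos_right (by positivity)] at h3
    have : a < b + 1 := by exact_mod_cast h3
    omega
  exact le_antisymm (key hi.1 hj.2) (key hj.1 hi.2)

theorem affineTerm_comp_self (f : ℝ → ℂ) {k j : ℕ} (hj : j < 2 ^ k) {t : ℝ}
    (ht : t ∈ Set.Ioc (0 : ℝ) 1) : affineTerm f (2 ^ k + j) (dyadicMap k j t) = f t := by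
  have h1 := affineTerm_dyadicMap f (l := 0) (r := 0) hj (by norm_num) t
  have h2 := affineTerm_eq_indicator f (k := 0) (j := 0) (by norm_num)
  simp only [pow_zero, one_mul, add_zero] at h1 h2
  rw [h1, h2, Set.indicator_of_mem (by simpa using ht)]
  simp

theorem affineTerm_support (f : ℝ → ℂ) {k j : ℕ} (hj : j < 2 ^ k) {t : ℝ}
    (ht : t ∉ Set.Ioc ((j : ℝ) / 2 ^ k) (((j : ℝ) + 1) / 2 ^ k)) :
    affineTerm f (2 ^ k + j) t = 0 := by
  rw [affineTerm_eq_indicator f hj, Set.indicator_of_notMem ht]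

theorem integral_affineTerm {f : ℝ → ℂ} (h0 : ∫ t, f t ∂unitMeasure = 0) {n : ℕ} (hn : 1 ≤ n) :
    ∫ t, affineTerm f n t ∂unitMeasure = 0 := by
  obtain ⟨k, j, hj, rfl⟩ := exists_level hn
  have h1 := integral_eq_of_support hj fun t ht => affineTerm_support f hj ht
  rw [integral_unitMeasure_congr fun t ht => affineTerm_comp_self f hj ht, h0] at h1
  exact (mul_eq_zero.1 h1).resolve_left (pow_ne_zero _ two_ne_zero)

theorem memLp_affineTerm {f : ℝ → ℂ} {p : ℝ≥0∞} (hf : MemLp f p unitMeasure) {n : ℕ}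
    (hn : 1 ≤ n) : MemLp (affineTerm f n) p unitMeasure := by
  obtain ⟨k, j, hj, rfl⟩ := exists_level hn
  have h1 : MemLp (affineTerm f (2 ^ k + j) ∘ dyadicMap k j) p unitMeasure :=
    hf.ae_eq (ae_unitMeasure_of_forall fun t ht => (affineTerm_comp_self f hj ht).symm)
  rw [← (measurableEmbedding_dyadicMap k j).memLp_map_measure_iff, map_dyadicMap] at h1
  have h2 := h1.smul_measure (c := (2 ^ k : ℝ≥0∞)⁻¹)
    (ENNReal.inv_ne_top.2 (pow_ne_zero _ two_ne_zero))
  rw [smul_smul, ENNReal.inv_mul_cancel (pow_ne_zero _ two_ne_zero) (by finiteness), one_smul] at h2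
  have h3 : Set.indicator (Set.Ioc ((j : ℝ) / 2 ^ k) (((j : ℝ) + 1) / 2 ^ k))
      (affineTerm f (2 ^ k + j)) = affineTerm f (2 ^ k + j) :=
    Set.indicator_eq_self.2 fun t ht => by
      by_contra h
      exact ht (affineTerm_support f hj h)
  rw [← h3, memLp_indicator_iff_restrict measurableSet_Ioc, unitMeasure,
    Measure.restrict_restrict measurableSet_Ioc, Set.inter_eq_left.2 (dyadic_Ioc_subset hj)]
  exact h2

theorem integrable_affineTerm {f : ℝ → ℂ} (hf : Integrable f unitMeasure) {n : ℕ}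
    (hn : 1 ≤ n) : Integrable (affineTerm f n) unitMeasure :=
  memLp_one_iff_integrable.1 (memLp_affineTerm (memLp_one_iff_integrable.2 hf) hn)

theorem multishift_single (c : ℕ → ℂ) {n : ℕ} (hn : 1 ≤ n) (m : ℕ) :
    multishift c (Pi.single n 1) m = ∑ i ∈ Finset.range m, if m = 2 ^ i * n then c i else 0 := by
  refine Finset.sum_congr rfl fun i _ => ?_
  rw [doubleShift_iterate]
  by_cases h : m = 2 ^ i * n
  · rw [if_pos h, if_pos (h ▸ dvd_mul_right _ _), h, Nat.mul_div_cancel_left _ (by positivity)]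
    simp
  · rw [if_neg h]
    split_ifs with hd
    · rw [Pi.single_eq_of_ne, mul_zero]
      rintro rfl
      exact h (Nat.mul_div_cancel' hd).symm
    · simp

theorem multishift_single_two_pow_mul (c : ℕ → ℂ) {n : ℕ} (hn : 1 ≤ n) (l : ℕ) :
    multishift c (Pi.single n 1) (2 ^ l * n) = c l := by
  rw [multishift_single c hn, Finset.sum_eq_single l]
  · simp
  · intro i _ hi
    rw [if_neg]
    intro h
    exact hi (Nat.pow_right_injective le_rfl (Nat.eq_of_mul_eq_mul_right hn h)).symm
  · intro h
    refine absurd (Finset.mem_range.2 ?_) h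
    calc l < 2 ^ l := Nat.lt_two_pow_self
      _ = 2 ^ l * 1 := by ring
      _ ≤ 2 ^ l * n := Nat.mul_le_mul_left _ hn

theorem multishift_single_of_ne (c : ℕ → ℂ) {n : ℕ} (hn : 1 ≤ n) {m : ℕ}
    (h : ∀ i, m ≠ 2 ^ i * n) : multishift c (Pi.single n 1) m = 0 := by
  rw [multishift_single c hn]
  exact Finset.sum_eq_zero fun i _ => if_neg (h i)

theorem exists_child {k l j : ℕ} (hj : j < 2 ^ (l + k)) :
    ∃ i r, i < 2 ^ k ∧ r < 2 ^ l ∧ 2 ^ (l + k) + j = 2 ^ l * (2 ^ k + i) + r := by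
  refine ⟨j / 2 ^ l, j % 2 ^ l, ?_, Nat.mod_lt _ (by positivity), ?_⟩
  · rw [Nat.div_lt_iff_lt_mul (by positivity), ← pow_add, add_comm k l]
    exact hj
  · rw [mul_add, pow_add, add_assoc, Nat.div_add_mod]

theorem child_injective {l a b r s : ℕ} (hr : r < 2 ^ l) (hs : s < 2 ^ l)
    (h : 2 ^ l * a + r = 2 ^ l * b + s) : a = b ∧ r = s := by
  have h1 := congrArg (· / 2 ^ l) h
  have h2 := congrArg (· % 2 ^ l) h
  simp only [Nat.mul_add_div (show 0 < 2 ^ l by positivity), Nat.div_eq_of_lt hr,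
    Nat.div_eq_of_lt hs, add_zero] at h1
  simp only [Nat.mul_add_mod, Nat.mod_eq_of_lt hr, Nat.mod_eq_of_lt hs] at h2
  exact ⟨h1, h2⟩

theorem log_child {k j l r : ℕ} (hj : j < 2 ^ k) (hr : r < 2 ^ l) :
    Nat.log 2 (2 ^ l * (2 ^ k + j) + r) = l + k := by
  rw [child_eq, log_two_pow_add (child_lt hj hr)]

/-- Tree-descendants are the only multiples by powers of two. -/
theorem eq_two_pow_mul_imp {k i j l r p : ℕ} (hi : i < 2 ^ k) (hj : j < 2 ^ k) (hr : r < 2 ^ l)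
    (h : 2 ^ l * (2 ^ k + i) + r = 2 ^ p * (2 ^ k + j)) : i = j ∧ r = 0 := by
  have h1 := congrArg (Nat.log 2) h
  have h2 := log_child (l := p) (r := 0) hj (by positivity)
  rw [add_zero] at h2
  rw [log_child hi hr, h2] at h1
  obtain rfl : l = p := by omega
  have := child_injective (s := 0) hr (by positivity) (h.trans (add_zero _).symm)
  omega

theorem integral_affineTerm_half {f : ℝ → ℂ} (h0 : ∫ t, f t ∂unitMeasure = 0) {l r b : ℕ}
    (hr : r < 2 ^ (l + 1)) (hb : b < 2 ^ 1) :
    ∫ t, affineTerm f (2 ^ (l + 1) + r) (dyadicMap 1 b t) ∂unitMeasure = 0 := by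
  obtain ⟨i, s, hi, hs, h⟩ := exists_child hr
  rw [h]
  by_cases hib : i = b
  · subst hib
    simp_rw [affineTerm_dyadicMap f hb hs]
    exact integral_affineTerm h0 (Nat.one_le_two_pow.trans (Nat.le_add_right _ _))
  · rw [integral_unitMeasure_congr (y := fun _ => 0)]
    · simp
    · intro t ht
      refine affineTerm_eq_zero_of_notMem f hi hs fun hmem => hib ?_
      rw [← dyadicMap_preimage 1 b] at ht
      exact dyadic_Ioc_unique hmem ht

/-- The Haar coefficients of the dilations and translations of a first-order chaos. -/
theorem haarCoeff_affineTerm {c : ℕ → ℂ} {f : ℝ → ℂ}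
    (hf : ∀ t ∈ Set.Ioc (0 : ℝ) 1, f t = firstChaos c t) (hint : Integrable f unitMeasure)
    (h0 : ∫ t, f t ∂unitMeasure = 0) {n m : ℕ} (hn : 1 ≤ n) (hm : 1 ≤ m) :
    haarCoeff (affineTerm f n) m = multishift c (Pi.single n 1) m := by
  obtain ⟨k, j, hj, rfl⟩ := exists_level hn
  obtain ⟨k', j', hj', rfl⟩ := exists_level hm
  rcases le_or_gt k k' with hk | hk
  · obtain ⟨l, rfl⟩ : ∃ l, k' = l + k := ⟨k' - k, by omega⟩
    obtain ⟨i, r, hi, hr, h⟩ := exists_child hj'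
    rw [h]
    by_cases hij : i = j
    · subst hij
      rw [← haarCoeff_comp_dyadicMap _ hi hr,
        haarCoeff_congr fun t ht => affineTerm_comp_self f hi ht]
      rcases Nat.eq_zero_or_pos r with rfl | hr0
      · rw [add_zero, add_zero, haarCoeff_firstChaos_two_pow l hf hint h0,
          multishift_single_two_pow_mul c hn]
      · rw [haarCoeff_firstChaos_of_pos hf hr hr0, multishift_single_of_ne c hn]
        intro p hp
        have := eq_two_pow_mul_imp hi hj hr hp
        omega
    · rw [multishift_single_of_ne c hn fun p hp => hij (eq_two_pow_mul_imp hi hj hr hp).1,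
        haarCoeff, integral_unitMeasure_congr (y := fun _ => 0)]
      · simp
      · intro t _
        by_cases ht : t ∈ Set.Ioc ((j : ℝ) / 2 ^ k) (((j : ℝ) + 1) / 2 ^ k)
        · rw [haarFun, affineTerm_eq_zero_of_notMem haarMother hi hr
            fun hmem => hij (dyadic_Ioc_unique hmem ht), mul_zero]
        · rw [affineTerm_support f hj ht, zero_mul]
  -- Here f_n lives strictly below the level of h_m, so h_m is constant on the support of f_n, or
  -- vanishes there, and f_n has mean zero.
  · obtain ⟨l, rfl⟩ : ∃ l, k = (l + 1) + k' := ⟨k - k' - 1, by omega⟩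
    rw [multishift_single_of_ne c hn]
    · obtain ⟨i, r, hi, hr, h⟩ := exists_child hj
      rw [haarCoeff_eq_comp _ hj', h]
      by_cases hij : i = j'
      · subst hij
        simp_rw [affineTerm_dyadicMap f hi hr]
        rw [haarCoeff_one (integrable_affineTerm hint
          (Nat.one_le_two_pow.trans (Nat.le_add_right _ _))),
          integral_affineTerm_half h0 hr (by norm_num),
          integral_affineTerm_half h0 hr (by norm_num)]
        simp
      · rw [haarCoeff_congr (y := fun _ => 0), haarCoeff_const _ le_rfl]
        intro t ht
        refine affineTerm_eq_zero_of_notMem f hi hr fun hmem => hij ?_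
        rw [← dyadicMap_preimage k' j'] at ht
        exact dyadic_Ioc_unique hmem ht
    · intro p hp
      have h1 := congrArg (Nat.log 2) hp
      have h2 := log_child (l := p) (r := 0) hj (by positivity)
      rw [add_zero] at h2
      rw [log_two_pow_add hj', h2] at h1
      omega

/-- The Haar system is the special case of coefficients (1, 0, 0, …), so its own coefficients and
orthogonality follow from the general computation. -/
theorem firstChaos_single_eq (t : ℝ) (ht : t ∈ Set.Ioc (0 : ℝ) 1) :
    haarMother t = firstChaos (Pi.single 0 1) t := by
  rw [firstChaos, tsum_eq_single 0 fun k hk => by simp [hk]]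
  simp [haarFun_one_of_mem ht]

theorem integrable_haarMother : Integrable haarMother unitMeasure :=
  Integrable.of_bound measurable_haarMother.aestronglyMeasurable 1
    (Eventually.of_forall norm_haarMother_le)

theorem integral_haarMother : ∫ t, haarMother t ∂unitMeasure = 0 := by
  have h := haarCoeff_const 1 le_rfl
  rw [haarCoeff] at h
  rw [← h, integral_unitMeasure_congr (y := fun t => 1 * haarFun 1 t)]
  · simp
  · intro t ht
    rw [haarFun_one_of_mem ht, one_mul]

theorem haarCoeff_haarFun {n m : ℕ} (hn : 1 ≤ n) (hm : 1 ≤ m) :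
    haarCoeff (haarFun n) m = if m = n then 1 else 0 := by
  rw [haarFun, haarCoeff_affineTerm firstChaos_single_eq integrable_haarMother integral_haarMother
    hn hm, multishift_single _ hn, Finset.sum_eq_single 0]
  · simp
  · intro i _ hi
    simp [hi]
  · intro h
    simp at h
    omega

/-! ### Completeness of the Haar system, Parseval and Riesz–Fischer -/

theorem dyadicMap_dyadicMap (k j b : ℕ) (t : ℝ) :
    dyadicMap k j (dyadicMap 1 b t) = dyadicMap (k + 1) (2 * j + b) t := by
  simp only [dyadicMap]
  push_cast
  rw [pow_succ]
  field_simp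
  ring

theorem integrable_comp_dyadicMap {x : ℝ → ℂ} (hx : Integrable x unitMeasure) {k j : ℕ}
    (hj : j < 2 ^ k) : Integrable (fun t => x (dyadicMap k j t)) unitMeasure :=
  memLp_one_iff_integrable.1 (memLp_comp_dyadicMap (memLp_one_iff_integrable.2 hx) hj)

/-- Half the sum and half the difference of the means over two sibling intervals are the parent's
mean and Haar coefficient; both vanish, so the zero means pass down the tree. -/
theorem integral_dyadic_eq_zero {x : ℝ → ℂ} (hx : Integrable x unitMeasure)
    (h0 : ∫ t, x t ∂unitMeasure = 0) (h : ∀ n, 1 ≤ n → haarCoeff x n = 0) (k : ℕ) :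
    ∀ j, j < 2 ^ k → ∫ t, x (dyadicMap k j t) ∂unitMeasure = 0 := by
  induction k with
  | zero =>
    intro j hj
    obtain rfl : j = 0 := by simpa using hj
    simpa [dyadicMap] using h0
  | succ k ih =>
    intro j hj
    have hi : j / 2 < 2 ^ k := by rw [pow_succ] at hj; omega
    have hint := integrable_comp_dyadicMap hx hi
    have h1 := ih _ hi
    have h2 := h _ (Nat.one_le_two_pow.trans (Nat.le_add_right (2 ^ k) (j / 2)))
    rw [integral_eq_half_add hint] at h1
    rw [haarCoeff_eq_comp _ hi, haarCoeff_one hint] at h2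
    simp_rw [dyadicMap_dyadicMap] at h1 h2
    rcases Nat.mod_two_eq_zero_or_one j with hb | hb
    · rw [show j = 2 * (j / 2) + 0 by omega]
      linear_combination h1 + h2
    · rw [show j = 2 * (j / 2) + 1 by omega]
      linear_combination h1 - h2

/-- Uniqueness of Haar coefficients. -/
theorem ae_eq_zero_of_haarCoeff_eq_zero {x : ℝ → ℂ} (hx : Integrable x unitMeasure)
    (h0 : ∫ t, x t ∂unitMeasure = 0) (h : ∀ n, 1 ≤ n → haarCoeff x n = 0) :
    x =ᵐ[unitMeasure] 0 := by
  obtain ⟨w, hw⟩ : ∃ w : ℝ → ℂ, w = Set.indicator (Set.Ioc 0 1) x := ⟨_, rfl⟩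
  have hwint : Integrable w volume := by
    rw [hw]; exact (integrable_indicator_iff measurableSet_Ioc).2 hx
  have hseg : ∀ k j : ℕ, j < 2 ^ k →
      ∫ t in ((j : ℝ) / 2 ^ k)..(((j + 1 : ℕ) : ℝ) / 2 ^ k), w t = 0 := by
    intro k j hj
    have h1 := integral_dyadic_eq_zero hx h0 h k j hj
    rw [integral_comp_dyadicMap] at h1
    have h2 := (mul_eq_zero.1 h1).resolve_left (pow_ne_zero _ two_ne_zero)
    rw [intervalIntegral.integral_of_le (by gcongr; omega), hw]
    push_cast
    rw [setIntegral_indicator measurableSet_Ioc, Set.inter_eq_left.2 (dyadic_Ioc_subset hj)]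
    exact h2
  have hF : ∀ k j : ℕ, j ≤ 2 ^ k → ∫ t in (0 : ℝ)..((j : ℝ) / 2 ^ k), w t = 0 := by
    intro k j
    induction j with
    | zero => simp
    | succ j ih =>
      intro hj
      rw [← intervalIntegral.integral_add_adjacent_intervals (b := (j : ℝ) / 2 ^ k)
        hwint.intervalIntegrable hwint.intervalIntegrable, ih (by omega), hseg k j (by omega),
        add_zero]
  have hcont : Continuous fun t : ℝ => ∫ s in (0 : ℝ)..t, w s :=
    intervalIntegral.continuous_primitive (fun _ _ => hwint.intervalIntegrable) 0
  -- The primitive vanishes at all dyadic points, hence on (0,1) by continuity; Lebesgue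
  -- differentiation then gives the function zero almost everywhere.
  have hzero : ∀ t ∈ Set.Ioo (0 : ℝ) 1, ∫ s in (0 : ℝ)..t, w s = 0 := by
    intro t ht
    have h1 : Tendsto (fun k : ℕ => (⌊t * (2 : ℝ) ^ k⌋₊ : ℝ) / 2 ^ k) atTop (𝓝 t) :=
      (tendsto_nat_floor_mul_div_atTop ht.1.le).comp
        (tendsto_pow_atTop_atTop_of_one_lt (one_lt_two (α := ℝ)))
    have h2 := (hcont.tendsto t).comp h1
    refine tendsto_nhds_unique h2 (tendsto_const_nhds.congr fun k => ?_)
    refine (hF k _ (Nat.floor_le_of_le ?_)).symm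
    push_cast
    have : (0 : ℝ) < 2 ^ k := by positivity
    nlinarith [ht.2]
  have hderiv := LocallyIntegrable.ae_hasDerivAt_integral hwint.locallyIntegrable
  have hne : ∀ᵐ t ∂(volume : Measure ℝ), t ≠ 1 := by
    simp [ae_iff]
  rw [unitMeasure, Filter.EventuallyEq, ae_restrict_iff' measurableSet_Ioc]
  filter_upwards [hderiv, hne] with t ht ht1 hmem
  have ht2 : t ∈ Set.Ioo (0 : ℝ) 1 := ⟨hmem.1, lt_of_le_of_ne hmem.2 ht1⟩
  have h3 : HasDerivAt (fun t : ℝ => ∫ s in (0 : ℝ)..t, w s) 0 t :=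
    (hasDerivAt_const t (0 : ℂ)).congr_of_eventuallyEq
      (eventually_of_mem (isOpen_Ioo.mem_nhds ht2) hzero)
  have h4 := (ht 0).unique h3
  rwa [hw, Set.indicator_of_mem hmem] at h4

/-- The `L²`-normalized Haar functions, with the constant function at index `0`. -/
def normHaar (n : ℕ) : ℝ → ℂ :=
  if n = 0 then fun _ => 1 else ((√(2 ^ Nat.log 2 n) : ℝ) : ℂ) • haarFun n

theorem memLp_normHaar (n : ℕ) : MemLp (normHaar n) 2 unitMeasure := by
  unfold normHaar
  split_ifs with h
  · exact memLp_const 1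
  · exact (memLp_haarFun (Nat.one_le_iff_ne_zero.2 h) 2).const_smul _

theorem conj_haarFun {n : ℕ} (hn : 1 ≤ n) (t : ℝ) :
    (starRingEnd ℂ) (haarFun n t) = haarFun n t := by
  obtain ⟨k, j, hj, rfl⟩ := exists_level hn
  rw [haarFun, affineTerm_eq_indicator _ hj, Set.indicator_apply]
  unfold haarMother
  split_ifs <;> simp

theorem inner_normHaar {y : ℝ → ℂ} (hy : MemLp y 2 unitMeasure) (n : ℕ) :
    inner ℂ ((memLp_normHaar n).toLp) (hy.toLp) =
      if n = 0 then ∫ t, y t ∂unitMeasure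
      else ((√(2 ^ Nat.log 2 n) : ℝ) : ℂ)⁻¹ * haarCoeff y n := by
  rw [MeasureTheory.L2.inner_def]
  have h1 : ∀ᵐ t ∂unitMeasure, inner ℂ ((memLp_normHaar n).toLp (normHaar n) t) (hy.toLp y t) =
      y t * (starRingEnd ℂ) (normHaar n t) := by
    filter_upwards [(memLp_normHaar n).coeFn_toLp, hy.coeFn_toLp] with t h1 h2
    rw [h1, h2, RCLike.inner_apply]
  rw [integral_congr_ae h1]
  split_ifs with hn
  · simp [normHaar, hn]
  · have hn1 := Nat.one_le_iff_ne_zero.2 hn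
    simp only [normHaar, if_neg hn, Pi.smul_apply, smul_eq_mul, map_mul, Complex.conj_ofReal,
      conj_haarFun hn1]
    have hs : ((√(2 ^ Nat.log 2 n) : ℝ) : ℂ) ≠ 0 := by
      norm_cast
      positivity
    have hs2 : ((√(2 ^ Nat.log 2 n) : ℝ) : ℂ) * ((√(2 ^ Nat.log 2 n) : ℝ) : ℂ) =
        2 ^ Nat.log 2 n := by
      norm_cast
      rw [Real.mul_self_sqrt (by positivity)]
    rw [haarCoeff, ← hs2, mul_assoc, inv_mul_cancel_left₀ hs, ← integral_const_mul]
    refine integral_congr_ae (Eventually.of_forall fun t => ?_)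
    simp only
    ring

theorem integral_haarFun {n : ℕ} (hn : 1 ≤ n) : ∫ t, haarFun n t ∂unitMeasure = 0 :=
  integral_affineTerm integral_haarMother hn

theorem orthonormal_normHaar : Orthonormal ℂ fun n => (memLp_normHaar n).toLp := by
  rw [orthonormal_iff_ite]
  intro i j
  rw [inner_normHaar (memLp_normHaar j)]
  rcases Nat.eq_zero_or_pos j with rfl | hj
  · rcases Nat.eq_zero_or_pos i with rfl | hi
    · simp [normHaar]
    · rw [if_neg hi.ne', if_neg hi.ne']
      simp only [normHaar, if_true]
      rw [haarCoeff_const _ hi, mul_zero]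
  · simp only [normHaar, if_neg hj.ne', haarCoeff_const_smul]
    rcases Nat.eq_zero_or_pos i with rfl | hi
    · simp only [if_true, Pi.smul_apply, smul_eq_mul]
      rw [integral_const_mul, integral_haarFun hj, mul_zero, if_neg (by omega)]
    · rw [if_neg hi.ne', haarCoeff_haarFun hj hi]
      split_ifs with hij
      · subst hij
        rw [mul_one, inv_mul_cancel₀]
        norm_cast
        positivity
      · simp

/-- The Haar system as a Hilbert basis of `L²(0,1]`. -/
def haarBasis : HilbertBasis ℕ ℂ (Lp ℂ 2 unitMeasure) :=
  HilbertBasis.mkOfOrthogonalEqBot orthonormal_normHaar (by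
    rw [Submodule.eq_bot_iff]
    intro v hv
    have hv' : ∀ n, inner ℂ ((memLp_normHaar n).toLp) ((Lp.memLp v).toLp) = (0 : ℂ) := fun n => by
      rw [Lp.toLp_coeFn]
      exact hv _ (Submodule.subset_span ⟨n, rfl⟩)
    simp_rw [inner_normHaar] at hv'
    have hint : Integrable v unitMeasure := (Lp.memLp v).integrable (by norm_num)
    refine Lp.ext ((ae_eq_zero_of_haarCoeff_eq_zero hint (by simpa using hv' 0)
      fun n hn => ?_).trans (Lp.coeFn_zero _ _ _).symm)
    have := hv' n
    rw [if_neg (by omega)] at this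
    refine (mul_eq_zero.1 this).resolve_left ?_
    simp)

theorem haarBasis_repr {y : ℝ → ℂ} (hy : MemLp y 2 unitMeasure) (n : ℕ) :
    haarBasis.repr hy.toLp n = if n = 0 then ∫ t, y t ∂unitMeasure
      else ((√(2 ^ Nat.log 2 n) : ℝ) : ℂ)⁻¹ * haarCoeff y n := by
  rw [HilbertBasis.repr_apply_apply, ← inner_normHaar hy, haarBasis,
    HilbertBasis.coe_mkOfOrthogonalEqBot]

theorem sum_levels {M : Type*} [AddCommMonoid M] (g : ℕ → M) (L : ℕ) :
    ∑ n ∈ Finset.range (2 ^ L), g n =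
      g 0 + ∑ l ∈ Finset.range L, ∑ r ∈ Finset.range (2 ^ l), g (2 ^ l + r) := by
  induction L with
  | zero => simp
  | succ L ih =>
    rw [Finset.sum_range_succ, ← add_assoc, ← ih, show (2 : ℕ) ^ (L + 1) = 2 ^ L + 2 ^ L by ring,
      Finset.sum_range_add]

theorem tsum_levels (g : ℕ → ℝ≥0∞) :
    ∑' n, g n = g 0 + ∑' l : ℕ, ∑ r ∈ Finset.range (2 ^ l), g (2 ^ l + r) := by
  have h1 := (ENNReal.summable (f := g)).hasSum.tendsto_sum_nat.comp
    (tendsto_pow_atTop_atTop_of_one_lt one_lt_two)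
  have h2 := ((ENNReal.summable (f := fun l : ℕ =>
    ∑ r ∈ Finset.range (2 ^ l), g (2 ^ l + r))).hasSum.tendsto_sum_nat).const_add (g 0)
  refine tendsto_nhds_unique h1 (h2.congr fun L => ?_)
  rw [Function.comp, sum_levels]

theorem tsum_enorm_sq_lp (a : lp (fun _ : ℕ => ℂ) 2) : ∑' n, ‖a n‖ₑ ^ 2 = ‖a‖ₑ ^ 2 := by
  have h := lp.hasSum_norm (p := 2) (by norm_num) a
  simp only [ENNReal.toReal_ofNat, Real.rpow_ofNat] at h
  simp_rw [← ofReal_norm, ← ENNReal.ofReal_pow (norm_nonneg _)]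
  rw [← h.tsum_eq, ENNReal.ofReal_tsum_of_nonneg (fun _ => by positivity) h.summable]

theorem enorm_inv_sqrt_mul_sq (k : ℕ) (z : ℂ) :
    ‖((√(2 ^ k) : ℝ) : ℂ)⁻¹ * z‖ₑ ^ 2 = (2 ^ k : ℝ≥0∞)⁻¹ * ‖z‖ₑ ^ 2 := by
  rw [enorm_mul, mul_pow]
  congr 1
  rw [← ofReal_norm, ← ENNReal.ofReal_pow (norm_nonneg _), norm_inv, Complex.norm_real,
    Real.norm_of_nonneg (Real.sqrt_nonneg _), inv_pow, Real.sq_sqrt (by positivity),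
    ENNReal.ofReal_inv_of_pos (by positivity), ENNReal.ofReal_pow (by norm_num)]
  simp

theorem tsum_weighted_eq_treeEnergy (ξ : ℕ → ℂ) {a : ℕ → ℂ} (h0 : a 0 = 0)
    (ha : ∀ n, n ≠ 0 → a n = ((√(2 ^ Nat.log 2 n) : ℝ) : ℂ)⁻¹ * ξ n) :
    ∑' n, ‖a n‖ₑ ^ 2 = treeEnergy ξ 1 := by
  rw [tsum_levels, h0]
  simp only [enorm_zero, ne_eq, OfNat.ofNat_ne_zero, not_false_eq_true, zero_pow, zero_add,
    treeEnergy]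
  refine tsum_congr fun l => ?_
  rw [Finset.mul_sum]
  refine Finset.sum_congr rfl fun r hr => ?_
  rw [ha _ (by have := Nat.one_le_two_pow (n := l); omega), log_two_pow_add (by simpa using hr),
    enorm_inv_sqrt_mul_sq, mul_one]

/-- Parseval's identity for the Haar system. -/
theorem eLpNorm_sq_of_integral_eq_zero {y : ℝ → ℂ} (hy : MemLp y 2 unitMeasure)
    (h0 : ∫ t, y t ∂unitMeasure = 0) :
    eLpNorm y 2 unitMeasure ^ 2 = treeEnergy (haarCoeff y) 1 := by
  rw [← Lp.enorm_toLp hy, ← haarBasis.repr.enorm_map, ← tsum_enorm_sq_lp]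
  refine tsum_weighted_eq_treeEnergy _ ?_ fun n hn => ?_
  · rw [haarBasis_repr, if_pos rfl, h0]
  · rw [haarBasis_repr, if_neg hn]

/-- The Riesz–Fischer theorem for the Haar system. -/
theorem exists_memLp_haarCoeff_eq {ξ : ℕ → ℂ} (hξ : treeEnergy ξ 1 ≠ ∞) :
    ∃ y : ℝ → ℂ, MemLp y 2 unitMeasure ∧ ∫ t, y t ∂unitMeasure = 0 ∧
      ∀ n, 1 ≤ n → haarCoeff y n = ξ n := by
  let a : ℕ → ℂ := fun n => if n = 0 then 0 else ((√(2 ^ Nat.log 2 n) : ℝ) : ℂ)⁻¹ * ξ n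
  have ha : ∑' n, ‖a n‖ₑ ^ 2 ≠ ∞ := by
    rw [tsum_weighted_eq_treeEnergy ξ (if_pos rfl) fun n hn => if_neg hn]
    exact hξ
  have hmem : Memℓp a 2 := by
    refine memℓp_gen ?_
    simp only [ENNReal.toReal_ofNat, Real.rpow_ofNat]
    have h1 := ENNReal.summable_toReal ha
    simpa using h1
  let v := haarBasis.repr.symm ⟨a, hmem⟩
  have hv : ∀ n, haarBasis.repr ((Lp.memLp v).toLp) n = a n := fun n => by
    rw [Lp.toLp_coeFn, LinearIsometryEquiv.apply_symm_apply]
  refine ⟨v, Lp.memLp v, ?_, fun n hn => ?_⟩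
  · have := hv 0
    rwa [haarBasis_repr, if_pos rfl] at this
  · have := hv n
    rw [haarBasis_repr, if_neg (by omega)] at this
    simp only [a, if_neg (show n ≠ 0 by omega)] at this
    refine mul_left_cancel₀ ?_ this
    simp

/-! ### BMO_d and VMO_d in terms of subtree energies -/

theorem eLpNorm_dyadicOsc_sq {x : ℝ → ℂ} (hx : MemLp x 2 unitMeasure) {k j : ℕ} (hj : j < 2 ^ k) :
    eLpNorm (dyadicOsc x k j) 2 unitMeasure ^ 2 = treeEnergy (haarCoeff x) (2 ^ k + j) := by
  have h1 := memLp_comp_dyadicMap hx hj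
  have hint := h1.integrable (q := 2) (by norm_num)
  have h2 : dyadicOsc x k j = (fun t => x (dyadicMap k j t)) -
      fun _ => ∫ t, x (dyadicMap k j t) ∂unitMeasure := rfl
  -- Parseval on the rescaled interval: subtracting the mean changes no Haar coefficient, and
  -- rescaling turns the subtree into the whole tree.
  rw [h2, eLpNorm_sq_of_integral_eq_zero (h1.sub (memLp_const _))]
  · unfold treeEnergy
    refine tsum_congr fun l => ?_
    congr 1
    refine Finset.sum_congr rfl fun r hr => ?_
    rw [mul_one, haarCoeff_sub hint (integrable_const _)
      (Nat.one_le_two_pow.trans (Nat.le_add_right _ _)),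
      haarCoeff_const _ (Nat.one_le_two_pow.trans (Nat.le_add_right _ _)), sub_zero,
      haarCoeff_comp_dyadicMap x hj (by simpa using hr)]
  · simp only [Pi.sub_apply]
    rw [integral_sub hint (integrable_const _)]
    simp

theorem levelOsc_le_iff {x : ℝ → ℂ} (hx : MemLp x 2 unitMeasure) (k : ℕ) (C : ℝ≥0∞) :
    levelOsc x k ≤ C ↔ ∀ j, j < 2 ^ k → treeEnergy (haarCoeff x) (2 ^ k + j) ≤ C ^ 2 := by
  rw [levelOsc, iSup_le_iff]
  constructor
  · intro h j hj
    rw [← eLpNorm_dyadicOsc_sq hx hj]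
    exact pow_le_pow_left₀ zero_le (h ⟨j, hj⟩) 2
  · intro h j
    have := h j j.2
    rw [← eLpNorm_dyadicOsc_sq hx j.2] at this
    exact (ENNReal.pow_le_pow_left_iff two_ne_zero).1 this

/-- This is the dictionary through which all norm estimates pass: a bound by C amounts to C²
bounding every subtree energy. -/
theorem bmoNorm_le_iff {x : ℝ → ℂ} (hx : MemLp x 2 unitMeasure) (C : ℝ≥0∞) :
    bmoNorm x ≤ C ↔ ∀ m, 1 ≤ m → treeEnergy (haarCoeff x) m ≤ C ^ 2 := by
  simp_rw [bmoNorm, iSup_le_iff, levelOsc_le_iff hx]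
  constructor
  · intro h m hm
    obtain ⟨k, j, hj, rfl⟩ := exists_level hm
    exact h k j hj
  · intro h k j _
    exact h _ (Nat.one_le_two_pow.trans (Nat.le_add_right _ _))

theorem enorm_haarCoeff_le_bmoNorm {x : ℝ → ℂ} (hx : MemLp x 2 unitMeasure) {n : ℕ} (hn : 1 ≤ n) :
    ‖haarCoeff x n‖ₑ ≤ bmoNorm x :=
  (ENNReal.pow_le_pow_left_iff two_ne_zero).1
    ((enorm_sq_le_treeEnergy _ _).trans ((bmoNorm_le_iff hx _).1 le_rfl n hn))

theorem bmoNorm_lt_top_iff {x : ℝ → ℂ} (hx : MemLp x 2 unitMeasure) :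
    bmoNorm x < ∞ ↔ BddEnergy (haarCoeff x) := by
  constructor
  · intro h
    exact ⟨bmoNorm x ^ 2, by finiteness, (bmoNorm_le_iff hx _).1 le_rfl⟩
  · rintro ⟨B, hB, h⟩
    -- B + 1 serves as a bound without taking a root, since B ≤ B + 1 ≤ (B + 1)².
    refine lt_of_le_of_lt ((bmoNorm_le_iff hx (B + 1)).2 fun m hm => (h m hm).trans ?_)
      (by finiteness : B + 1 < ∞)
    calc B ≤ B + 1 := le_self_add
      _ = (B + 1) ^ 1 := (pow_one _).symm
      _ ≤ (B + 1) ^ 2 := pow_le_pow_right₀ le_add_self one_le_two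

theorem tendsto_levelOsc_iff {x : ℝ → ℂ} (hx : MemLp x 2 unitMeasure) :
    Tendsto (levelOsc x) atTop (𝓝 0) ↔ VanishingEnergy (haarCoeff x) := by
  rw [ENNReal.tendsto_nhds_zero]
  constructor
  · intro h ε hε
    -- Capping at 1 makes the square at most ε.
    obtain ⟨K, hK⟩ := eventually_atTop.1 (h (min 1 ε) (lt_min one_pos hε))
    refine ⟨K, fun m hm => ?_⟩
    obtain ⟨k, j, hj, rfl⟩ := exists_level (Nat.one_le_two_pow.trans hm)
    have hKk : K ≤ k := by
      have : 2 ^ K < 2 ^ (k + 1) := by rw [pow_succ]; omega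
      have := (Nat.pow_lt_pow_iff_right one_lt_two).1 this
      omega
    refine ((levelOsc_le_iff hx k _).1 (hK k hKk) j hj).trans ?_
    calc min 1 ε ^ 2 ≤ min 1 ε ^ 1 := pow_le_pow_right_of_le_one' (min_le_left _ _) one_le_two
      _ ≤ ε := by rw [pow_one]; exact min_le_right _ _
  · intro h ε hε
    obtain ⟨K, hK⟩ := h (ε ^ 2) (ENNReal.pow_pos hε 2)
    refine eventually_atTop.2 ⟨K, fun k hk => (levelOsc_le_iff hx k ε).2 fun j _ => hK _ ?_⟩
    exact (Nat.pow_le_pow_right two_pos hk).trans (Nat.le_add_right _ _)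

theorem BddEnergy.congr {ξ η : ℕ → ℂ} (h : ∀ n, 1 ≤ n → ξ n = η n) (hξ : BddEnergy ξ) :
    BddEnergy η := by
  obtain ⟨B, hB, hξ⟩ := hξ
  refine ⟨B, hB, fun m hm => ?_⟩
  rw [← treeEnergy_congr fun n hn => h n (hm.trans hn)]
  exact hξ m hm

theorem VanishingEnergy.congr {ξ η : ℕ → ℂ} (h : ∀ n, 1 ≤ n → ξ n = η n)
    (hξ : VanishingEnergy ξ) : VanishingEnergy η := by
  intro ε hε
  obtain ⟨K, hK⟩ := hξ ε hε
  refine ⟨K, fun m hm => ?_⟩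
  rw [← treeEnergy_congr fun n hn => h n ((Nat.one_le_two_pow.trans hm).trans hn)]
  exact hK m hm

theorem mem_dyadicBMO_iff {x : ℝ → ℂ} : x ∈ dyadicBMO ↔ MemLp x 2 unitMeasure ∧
    ∫ t, x t ∂unitMeasure = 0 ∧ BddEnergy (haarCoeff x) := by
  constructor
  · rintro ⟨h1, h2, h3⟩
    exact ⟨h1, h2, (bmoNorm_lt_top_iff h1).1 h3⟩
  · rintro ⟨h1, h2, h3⟩
    exact ⟨h1, h2, (bmoNorm_lt_top_iff h1).2 h3⟩

theorem mem_dyadicVMO_iff {x : ℝ → ℂ} :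
    x ∈ dyadicVMO ↔ x ∈ dyadicBMO ∧ VanishingEnergy (haarCoeff x) := by
  constructor
  · rintro ⟨h1, h2⟩
    exact ⟨h1, (tendsto_levelOsc_iff h1.1).1 h2⟩
  · rintro ⟨h1, h2⟩
    exact ⟨h1, (tendsto_levelOsc_iff h1.1).2 h2⟩

theorem treeEnergy_eq_zero {ξ : ℕ → ℂ} {m : ℕ} (h : ∀ n, m ≤ n → ξ n = 0) :
    treeEnergy ξ m = 0 := by
  rw [treeEnergy_congr (η := fun _ => 0) h]
  simp [treeEnergy]

theorem vanishingEnergy_of_eventually_zero {ξ : ℕ → ℂ} {N : ℕ} (h : ∀ n, N ≤ n → ξ n = 0) :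
    VanishingEnergy ξ := by
  intro ε _
  refine ⟨N, fun m hm => ?_⟩
  rw [treeEnergy_eq_zero fun n hn => h n (Nat.lt_two_pow_self.le.trans (hm.trans hn))]
  exact zero_le

/-- Sequences of modulus at most one with at most one nonzero entry in each level of a subtree have
energy at most two. -/
theorem treeEnergy_le_two {ξ : ℕ → ℂ} (h1 : ∀ n, ‖ξ n‖ ≤ 1) {m : ℕ}
    (h : ∀ l r s, r < 2 ^ l → s < 2 ^ l → ξ (2 ^ l * m + r) ≠ 0 → ξ (2 ^ l * m + s) ≠ 0 → r = s) :
    treeEnergy ξ m ≤ 2 := by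
  calc treeEnergy ξ m ≤ ∑' l : ℕ, (2⁻¹ : ℝ≥0∞) ^ l := by
        refine ENNReal.tsum_le_tsum fun l => ?_
        rw [ENNReal.inv_pow]
        refine mul_le_of_le_one_right zero_le ?_
        by_cases hex : ∃ r, r < 2 ^ l ∧ ξ (2 ^ l * m + r) ≠ 0
        · obtain ⟨r, hr, hr0⟩ := hex
          rw [Finset.sum_eq_single r]
          · refine pow_le_one₀ zero_le ?_
            rw [← ofReal_norm]
            exact ENNReal.ofReal_le_one.2 (h1 _)
          · intro s hs hsr
            by_contra hne
            exact hsr (h l s r (by simpa using hs) hr (fun h0 => hne (by simp [h0])) hr0)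
          · exact fun hr' => absurd (Finset.mem_range.2 hr) hr'
        · rw [Finset.sum_eq_zero]
          · exact zero_le
          · intro r hr
            have : ξ (2 ^ l * m + r) = 0 := by
              by_contra h0
              exact hex ⟨r, by simpa using hr, h0⟩
            simp [this]
    _ = 2 := by rw [ENNReal.tsum_geometric, ENNReal.one_sub_inv_two, inv_inv]

/-- In the subtree of m, a power of two can only be a leftmost descendant 2^l m, so level l
contributes at most 2^{-l}. First-order chaoses thus have norm comparable to the supremum of their
coefficients. -/
theorem treeEnergy_lacunary_le {ξ : ℕ → ℂ} (h1 : ∀ n, ‖ξ n‖ ≤ 1)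
    (h : ∀ n, (∀ k, n ≠ 2 ^ k) → ξ n = 0) (m : ℕ) (hm : 1 ≤ m) : treeEnergy ξ m ≤ 2 := by
  have key : ∀ l r, r < 2 ^ l → ξ (2 ^ l * m + r) ≠ 0 → r = 0 := by
    intro l r hr h0
    obtain ⟨a, ha⟩ : ∃ a, 2 ^ l * m + r = 2 ^ a := by
      by_contra hne
      exact h0 (h _ fun k hk => hne ⟨k, hk⟩)
    have h2 : 2 ^ l * 1 ≤ 2 ^ l * m := Nat.mul_le_mul_left _ hm
    have hla : l ≤ a := (Nat.pow_le_pow_iff_right one_lt_two).1 (by omega)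
    have h3 : 2 ^ l ∣ r := (Nat.dvd_add_right (dvd_mul_right _ _)).1 (ha ▸ pow_dvd_pow 2 hla)
    exact Nat.eq_zero_of_dvd_of_lt h3 hr
  refine treeEnergy_le_two h1 fun l r s hr hs h2 h3 => ?_
  rw [key l r hr h2, key l s hs h3]

theorem bddEnergy_single (n : ℕ) : BddEnergy (Pi.single n 1) := by
  refine ⟨2, by finiteness, fun m _ => treeEnergy_le_two (fun k => ?_) fun l r s _ _ h1 h2 => ?_⟩
  · rw [Pi.single_apply]
    split_ifs <;> simp
  · simp only [Pi.single_apply, ne_eq, ite_eq_right_iff, one_ne_zero, imp_false, not_not] at h1 h2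
    omega

/-- The sequence `a` restricted to the finite set `F`. -/
def restrictSeq (F : Finset ℕ) (a : ℕ → ℂ) (n : ℕ) : ℂ := ∑ k ∈ F, a k * (Pi.single k 1 : ℕ → ℂ) n

theorem restrictSeq_apply (F : Finset ℕ) (a : ℕ → ℂ) (n : ℕ) :
    restrictSeq F a n = if n ∈ F then a n else 0 := by
  simp [restrictSeq, Pi.single_apply]

theorem memLp_sum_affineTerm {f : ℝ → ℂ} (hf : MemLp f 2 unitMeasure) {F : Finset ℕ}
    (hF : ∀ n ∈ F, 1 ≤ n) (a : ℕ → ℂ) : MemLp (∑ n ∈ F, a n • affineTerm f n) 2 unitMeasure :=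
  memLp_finsetSum' F fun n hn => (memLp_affineTerm hf (hF n hn)).const_smul (a n)

theorem integral_sum_affineTerm {f : ℝ → ℂ} (hf : Integrable f unitMeasure)
    (h0 : ∫ t, f t ∂unitMeasure = 0) {F : Finset ℕ} (hF : ∀ n ∈ F, 1 ≤ n) (a : ℕ → ℂ) :
    ∫ t, (∑ n ∈ F, a n • affineTerm f n) t ∂unitMeasure = 0 := by
  simp only [Finset.sum_apply, Pi.smul_apply, smul_eq_mul]
  rw [integral_finsetSum _ fun n hn => (integrable_affineTerm hf (hF n hn)).const_mul _]
  refine Finset.sum_eq_zero fun n hn => ?_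
  rw [integral_const_mul, integral_affineTerm h0 (hF n hn), mul_zero]

theorem haarCoeff_sum_affineTerm {c : ℕ → ℂ} {f : ℝ → ℂ}
    (hf : ∀ t ∈ Set.Ioc (0 : ℝ) 1, f t = firstChaos c t) (hint : Integrable f unitMeasure)
    (h0 : ∫ t, f t ∂unitMeasure = 0) {F : Finset ℕ} (hF : ∀ n ∈ F, 1 ≤ n) (a : ℕ → ℂ) {m : ℕ}
    (hm : 1 ≤ m) :
    haarCoeff (∑ n ∈ F, a n • affineTerm f n) m = multishift c (restrictSeq F a) m := by
  rw [haarCoeff_sum F (fun n hn => (integrable_affineTerm hint (hF n hn)).smul (a n)) hm]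
  unfold restrictSeq
  rw [multishift_sum]
  refine Finset.sum_congr rfl fun n hn => ?_
  rw [haarCoeff_const_smul, haarCoeff_affineTerm hf hint h0 (hF n hn) hm]

theorem haarCoeff_sum_haarFun {F : Finset ℕ} (hF : ∀ n ∈ F, 1 ≤ n) (a : ℕ → ℂ) {m : ℕ}
    (hm : 1 ≤ m) : haarCoeff (∑ n ∈ F, a n • haarFun n) m = restrictSeq F a m := by
  have hint : ∀ n ∈ F, Integrable (a n • haarFun n) unitMeasure := fun n hn =>
    (integrable_affineTerm integrable_haarMother (hF n hn)).smul (a n)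
  rw [haarCoeff_sum F hint hm]
  refine Finset.sum_congr rfl fun n hn => ?_
  rw [haarCoeff_const_smul, haarCoeff_haarFun (hF n hn) hm, Pi.single_apply]

theorem memLp_haarMother : MemLp haarMother 2 unitMeasure :=
  MemLp.of_bound measurable_haarMother.aestronglyMeasurable 1
    (Eventually.of_forall norm_haarMother_le)

theorem memLp_sum_haarFun {F : Finset ℕ} (hF : ∀ n ∈ F, 1 ≤ n) (a : ℕ → ℂ) :
    MemLp (∑ n ∈ F, a n • haarFun n) 2 unitMeasure :=
  memLp_sum_affineTerm memLp_haarMother hF a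

/-- Boundedness of multishifts in the norm of `BMO_d`. -/
theorem bmoNorm_le_of_multishift {c : ℕ → ℂ} {x y : ℝ → ℂ} (hx : MemLp x 2 unitMeasure)
    (hy : MemLp y 2 unitMeasure)
    (h : ∀ n, 1 ≤ n → haarCoeff y n = multishift c (haarCoeff x) n) :
    bmoNorm y ≤ 2 * (∑' i, ‖c i‖ₑ) * bmoNorm x := by
  rw [bmoNorm_le_iff hy]
  intro m hm
  rw [treeEnergy_congr fun n hn => h n (hm.trans hn)]
  refine (treeEnergy_multishift_le_of_le ((bmoNorm_le_iff hx _).1 le_rfl) m hm).trans ?_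
  calc (∑' i, ‖c i‖ₑ) ^ 2 * (2 * bmoNorm x ^ 2) ≤ (∑' i, ‖c i‖ₑ) ^ 2 * (4 * bmoNorm x ^ 2) := by
        gcongr; norm_num
    _ = _ := by ring

theorem tendsto_zero_of_sq {u v : ℕ → ℝ≥0∞} (h : ∀ N, u N ^ 2 ≤ v N)
    (hv : Tendsto v atTop (𝓝 0)) : Tendsto u atTop (𝓝 0) := by
  rw [ENNReal.tendsto_nhds_zero] at hv ⊢
  intro ε hε
  filter_upwards [hv (ε ^ 2) (ENNReal.pow_pos hε 2)] with N hN
  exact (ENNReal.pow_le_pow_left_iff two_ne_zero).1 ((h N).trans hN)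

theorem weighted_enorm_sq_le_treeEnergy_one (ξ : ℕ → ℂ) {k j : ℕ} (hj : j < 2 ^ k) :
    (2 ^ k : ℝ≥0∞)⁻¹ * ‖ξ (2 ^ k + j)‖ₑ ^ 2 ≤ treeEnergy ξ 1 := by
  refine le_trans ?_ (ENNReal.le_tsum k)
  gcongr
  have := Finset.single_le_sum (f := fun r => ‖ξ (2 ^ k * 1 + r)‖ₑ ^ 2) (fun _ _ => zero_le)
    (Finset.mem_range.2 hj)
  simpa using this

theorem one_le_of_mem_Ico {N n : ℕ} (hn : n ∈ Finset.Ico 1 N) : 1 ≤ n := (Finset.mem_Ico.1 hn).1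

/-! ### T_f in Haar coefficients, and its boundedness for summable c -/

section MultishiftImage

variable {c : ℕ → ℂ} {f : ℝ → ℂ}

theorem haarCoeff_sub_sum (hf : ∀ t ∈ Set.Ioc (0 : ℝ) 1, f t = firstChaos c t)
    (hf2 : MemLp f 2 unitMeasure) (h0 : ∫ t, f t ∂unitMeasure = 0) {y : ℝ → ℂ}
    (hy : MemLp y 2 unitMeasure) {F : Finset ℕ} (hF : ∀ n ∈ F, 1 ≤ n) (a : ℕ → ℂ) {m : ℕ}
    (hm : 1 ≤ m) : haarCoeff (y - ∑ n ∈ F, a n • affineTerm f n) m =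
      haarCoeff y m - multishift c (restrictSeq F a) m := by
  rw [haarCoeff_sub (hy.integrable (by norm_num))
    ((memLp_sum_affineTerm hf2 hF a).integrable (by norm_num)) hm,
    haarCoeff_sum_affineTerm hf (hf2.integrable (by norm_num)) h0 hF a hm]

/-- T_f is triangular: its m-th output coefficient involves only inputs of index at most m, so the
m-th coefficient of the remainder is independent of N once N > m. -/
theorem haarCoeff_sub_sum_Ico_of_lt (hf : ∀ t ∈ Set.Ioc (0 : ℝ) 1, f t = firstChaos c t)
    (hf2 : MemLp f 2 unitMeasure) (h0 : ∫ t, f t ∂unitMeasure = 0) {y : ℝ → ℂ}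
    (hy : MemLp y 2 unitMeasure) (a : ℕ → ℂ) {m N : ℕ} (hm : 1 ≤ m) (hN : m < N) :
    haarCoeff (y - ∑ n ∈ Finset.Ico 1 N, a n • affineTerm f n) m =
      haarCoeff y m - multishift c a m := by
  rw [haarCoeff_sub_sum hf hf2 h0 hy (fun n hn => one_le_of_mem_Ico hn) a hm]
  congr 1
  refine multishift_congr hm fun n hn hnm => ?_
  rw [restrictSeq_apply, if_pos (Finset.mem_Ico.2 ⟨hn, by omega⟩)]

theorem haarCoeff_sub_sum_Ico_eq_tail (hf : ∀ t ∈ Set.Ioc (0 : ℝ) 1, f t = firstChaos c t)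
    (hf2 : MemLp f 2 unitMeasure) (h0 : ∫ t, f t ∂unitMeasure = 0) {y : ℝ → ℂ}
    (hy : MemLp y 2 unitMeasure) {a : ℕ → ℂ}
    (hya : ∀ n, 1 ≤ n → haarCoeff y n = multishift c a n) {m : ℕ} (N : ℕ) (hm : 1 ≤ m) :
    haarCoeff (y - ∑ n ∈ Finset.Ico 1 N, a n • affineTerm f n) m =
      multishift c (seqTail a N) m := by
  rw [haarCoeff_sub_sum hf hf2 h0 hy (fun n hn => one_le_of_mem_Ico hn) a hm, hya m hm,
    ← multishift_sub]
  refine multishift_congr hm fun n hn _ => ?_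
  rw [restrictSeq_apply, seqTail]
  simp only [Finset.mem_Ico]
  split_ifs <;> first | omega | simp

/-- L² convergence forces each coefficient of the remainder to tend to zero, while triangularity
makes it eventually constant. -/
theorem haarCoeff_of_isMultishiftImage (hf : ∀ t ∈ Set.Ioc (0 : ℝ) 1, f t = firstChaos c t)
    (hf2 : MemLp f 2 unitMeasure) (h0 : ∫ t, f t ∂unitMeasure = 0) {x y : ℝ → ℂ}
    (hy : MemLp y 2 unitMeasure) (hy0 : ∫ t, y t ∂unitMeasure = 0)
    (h : IsMultishiftImage f x y) {m : ℕ} (hm : 1 ≤ m) :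
    haarCoeff y m = multishift c (haarCoeff x) m := by
  obtain ⟨k, j, hj, rfl⟩ := exists_level hm
  have hsq : Tendsto (fun N : ℕ => eLpNorm (y - ∑ n ∈ Finset.Ico 1 N,
      haarCoeff x n • affineTerm f n) 2 unitMeasure ^ 2) atTop (𝓝 0) := by
    simpa using ENNReal.Tendsto.pow (n := 2) h
  have hle : (2 ^ k : ℝ≥0∞)⁻¹ * ‖haarCoeff y (2 ^ k + j) -
      multishift c (haarCoeff x) (2 ^ k + j)‖ₑ ^ 2 ≤ 0 := by
    refine ge_of_tendsto hsq (eventually_atTop.2 ⟨2 ^ k + j + 1, fun N hN => ?_⟩)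
    have hF : ∀ n ∈ Finset.Ico 1 N, 1 ≤ n := fun n hn => one_le_of_mem_Ico hn
    rw [eLpNorm_sq_of_integral_eq_zero (hy.sub (memLp_sum_affineTerm hf2 hF _)),
      ← haarCoeff_sub_sum_Ico_of_lt hf hf2 h0 hy _ hm hN]
    · exact weighted_enorm_sq_le_treeEnergy_one _ hj
    · simp only [Pi.sub_apply]
      rw [integral_sub (hy.integrable (by norm_num))
        ((memLp_sum_affineTerm hf2 hF _).integrable (by norm_num)), hy0,
        integral_sum_affineTerm (hf2.integrable (by norm_num)) h0 hF, sub_zero]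
  have h1 := (mul_eq_zero.1 (le_antisymm hle zero_le)).resolve_left
    (ENNReal.inv_ne_zero.2 (by finiteness))
  rw [pow_eq_zero_iff two_ne_zero, enorm_eq_zero, sub_eq_zero] at h1
  exact h1

/-- The remainder after N terms is the multishift of the tail of ξ, whose energy at the root of the
tree tends to zero. -/
theorem isMultishiftImage_of_haarCoeff (hf : ∀ t ∈ Set.Ioc (0 : ℝ) 1, f t = firstChaos c t)
    (hf2 : MemLp f 2 unitMeasure) (h0 : ∫ t, f t ∂unitMeasure = 0) (hc : ∑' i, ‖c i‖ₑ ≠ ∞)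
    {x y : ℝ → ℂ} (hy : MemLp y 2 unitMeasure) (hy0 : ∫ t, y t ∂unitMeasure = 0)
    (hx : treeEnergy (haarCoeff x) 1 ≠ ∞)
    (h : ∀ n, 1 ≤ n → haarCoeff y n = multishift c (haarCoeff x) n) :
    IsMultishiftImage f x y := by
  refine tendsto_zero_of_sq (fun N => ?_) (tendsto_mul_zero_of_ne_top
    (a := (∑' i, ‖c i‖ₑ) ^ 2) (by finiteness) (tendsto_treeEnergy_seqTail hx))
  have hF : ∀ n ∈ Finset.Ico 1 N, 1 ≤ n := fun n hn => one_le_of_mem_Ico hn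
  rw [eLpNorm_sq_of_integral_eq_zero (hy.sub (memLp_sum_affineTerm hf2 hF _)),
    treeEnergy_congr fun n hn => haarCoeff_sub_sum_Ico_eq_tail hf hf2 h0 hy h N hn]
  · exact treeEnergy_multishift_one_le _ _
  · simp only [Pi.sub_apply]
    rw [integral_sub (hy.integrable (by norm_num))
      ((memLp_sum_affineTerm hf2 hF _).integrable (by norm_num)), hy0,
      integral_sum_affineTerm (hf2.integrable (by norm_num)) h0 hF, sub_zero]

/-- If `∑ |c_k| < ∞`, then `T_f` is bounded on each space of functions in `BMO_d` with Haar
coefficients vanishing outside a set of indices stable under doubling. -/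
theorem multishiftBoundedOn_of_summable (hf : ∀ t ∈ Set.Ioc (0 : ℝ) 1, f t = firstChaos c t)
    (hf2 : MemLp f 2 unitMeasure) (h0 : ∫ t, f t ∂unitMeasure = 0)
    (hc : Summable fun k => ‖c k‖) {S : Set ℕ} (hS : ∀ n, n ∈ S → 2 * n ∈ S)
    {X : Set (ℝ → ℂ)}
    (hX : ∀ x, x ∈ X ↔ (∀ n, 1 ≤ n → n ∉ S → haarCoeff x n = 0) ∧ x ∈ dyadicBMO) :
    MultishiftBoundedOn f X := by
  rw [← tsum_enorm_ne_top_iff] at hc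
  refine ⟨(2 * ∑' i, ‖c i‖ₑ).toNNReal, fun x hx => ?_⟩
  rw [ENNReal.coe_toNNReal (by finiteness)]
  obtain ⟨hxS, hxB⟩ := (hX x).1 hx
  obtain ⟨hx1, hx2, hx3⟩ := mem_dyadicBMO_iff.1 hxB
  have hb := hx3.multishift hc
  have hfin : ∀ {ξ : ℕ → ℂ}, BddEnergy ξ → treeEnergy ξ 1 ≠ ∞ := fun {ξ} ⟨B, hB, h⟩ =>
    ((h 1 le_rfl).trans_lt hB).ne
  obtain ⟨y, hy1, hy2, hy3⟩ := exists_memLp_haarCoeff_eq (hfin hb)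
  refine ⟨y, (hX y).2 ⟨fun n hn hnS => ?_, mem_dyadicBMO_iff.2 ⟨hy1, hy2,
    hb.congr fun n hn => (hy3 n hn).symm⟩⟩, ?_, bmoNorm_le_of_multishift hx1 hy1 hy3⟩
  · rw [hy3 n hn, multishift_eq_zero_of_notMem hS hxS hn hnS]
  · exact isMultishiftImage_of_haarCoeff hf hf2 h0 hc hy1 hy2 (hfin hx3) hy3

end MultishiftImage

/-! ### Chaos index sets and finite first-order test functions -/

theorem mem_chaosIndex_one {n : ℕ} : n ∈ chaosIndex 1 ↔ ∃ k, n = 2 ^ k := by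
  constructor
  · rintro ⟨e, he, rfl⟩
    obtain ⟨k, rfl⟩ := Finset.card_eq_one.1 he
    exact ⟨k, by simp⟩
  · rintro ⟨k, rfl⟩
    exact ⟨{k}, by simp, by simp⟩

theorem two_mul_mem_chaosIndex {s n : ℕ} (h : n ∈ chaosIndex s) : 2 * n ∈ chaosIndex s := by
  obtain ⟨e, he, rfl⟩ := h
  refine ⟨e.map ⟨Nat.succ, Nat.succ_injective⟩, by simpa using he, ?_⟩
  simp [Finset.mul_sum, pow_succ']

theorem one_le_of_mem_chaosIndex {s n : ℕ} (hs : 1 ≤ s) (h : n ∈ chaosIndex s) : 1 ≤ n := by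
  obtain ⟨e, he, rfl⟩ := h
  obtain ⟨k, hk⟩ := Finset.card_pos.1 (he ▸ hs)
  exact Nat.one_le_two_pow.trans
    (Finset.single_le_sum (f := fun i => 2 ^ i) (fun _ _ => Nat.zero_le _) hk)

/-- The first `m + 1` powers of two. -/
def powersUpTo (m : ℕ) : Finset ℕ := (Finset.range (m + 1)).image (2 ^ ·)

theorem two_pow_mem_powersUpTo {m j : ℕ} : 2 ^ j ∈ powersUpTo m ↔ j ≤ m := by
  simp [powersUpTo]

theorem exists_of_mem_powersUpTo {m n : ℕ} (h : n ∈ powersUpTo m) : ∃ j, j ≤ m ∧ n = 2 ^ j := by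
  simp only [powersUpTo, Finset.mem_image, Finset.mem_range] at h
  obtain ⟨j, hj, rfl⟩ := h
  exact ⟨j, by omega, rfl⟩

theorem one_le_of_mem_powersUpTo {m n : ℕ} (h : n ∈ powersUpTo m) : 1 ≤ n := by
  obtain ⟨j, -, rfl⟩ := exists_of_mem_powersUpTo h
  exact Nat.one_le_two_pow

/-- The finite first-order chaos `∑_{j ≤ m} x_j h_{2^j}`. -/
def finiteChaos (x : ℕ → ℂ) (m : ℕ) : ℝ → ℂ :=
  ∑ n ∈ powersUpTo m, x (Nat.log 2 n) • haarFun n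

/-- The coefficients of `∑_{j ≤ m} x_j h_{2^j}`. -/
def finiteChaosCoeff (x : ℕ → ℂ) (m : ℕ) : ℕ → ℂ :=
  restrictSeq (powersUpTo m) fun n => x (Nat.log 2 n)

theorem finiteChaosCoeff_two_pow (x : ℕ → ℂ) (m j : ℕ) :
    finiteChaosCoeff x m (2 ^ j) = if j ≤ m then x j else 0 := by
  rw [finiteChaosCoeff, restrictSeq_apply, Nat.log_pow one_lt_two]
  simp only [two_pow_mem_powersUpTo]

theorem finiteChaosCoeff_of_ne {n : ℕ} (x : ℕ → ℂ) (m : ℕ) (h : ∀ k, n ≠ 2 ^ k) :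
    finiteChaosCoeff x m n = 0 := by
  rw [finiteChaosCoeff, restrictSeq_apply, if_neg]
  intro hn
  obtain ⟨j, -, hj⟩ := exists_of_mem_powersUpTo hn
  exact h j hj

theorem haarCoeff_finiteChaos (x : ℕ → ℂ) (m : ℕ) {n : ℕ} (hn : 1 ≤ n) :
    haarCoeff (finiteChaos x m) n = finiteChaosCoeff x m n :=
  haarCoeff_sum_haarFun (fun _ h => one_le_of_mem_powersUpTo h) _ hn

theorem memLp_finiteChaos (x : ℕ → ℂ) (m : ℕ) : MemLp (finiteChaos x m) 2 unitMeasure :=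
  memLp_sum_haarFun (fun _ h => one_le_of_mem_powersUpTo h) _

theorem treeEnergy_finiteChaos_le {x : ℕ → ℂ} (hx : ∀ j, ‖x j‖ ≤ 1) (m n : ℕ) (hn : 1 ≤ n) :
    treeEnergy (haarCoeff (finiteChaos x m)) n ≤ 2 := by
  rw [treeEnergy_congr fun k hk => haarCoeff_finiteChaos x m (hn.trans hk)]
  refine treeEnergy_lacunary_le (fun k => ?_) (fun k hk => finiteChaosCoeff_of_ne x m hk) n hn
  rw [finiteChaosCoeff, restrictSeq_apply]
  split_ifs
  · exact hx _
  · simp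

theorem bmoNorm_finiteChaos_le {x : ℕ → ℂ} (hx : ∀ j, ‖x j‖ ≤ 1) (m : ℕ) :
    bmoNorm (finiteChaos x m) ≤ 2 :=
  (bmoNorm_le_iff (memLp_finiteChaos x m) 2).2 fun n hn =>
    (treeEnergy_finiteChaos_le hx m n hn).trans (by norm_num)

theorem finiteChaos_mem {x : ℕ → ℂ} (hx : ∀ j, ‖x j‖ ≤ 1) (m : ℕ) :
    finiteChaos x m ∈ haarChaos 1 ∩ dyadicVMO := by
  refine ⟨fun n hn hn1 => ?_, mem_dyadicVMO_iff.2 ⟨mem_dyadicBMO_iff.2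
    ⟨memLp_finiteChaos x m, ?_, 2, by finiteness, treeEnergy_finiteChaos_le hx m⟩, ?_⟩⟩
  · rw [haarCoeff_finiteChaos x m hn]
    exact finiteChaosCoeff_of_ne x m fun k hk => hn1 (mem_chaosIndex_one.2 ⟨k, hk⟩)
  · exact integral_sum_affineTerm integrable_haarMother integral_haarMother
      (fun _ h => one_le_of_mem_powersUpTo h) _
  · refine VanishingEnergy.congr (fun n hn => (haarCoeff_finiteChaos x m hn).symm)
      (vanishingEnergy_of_eventually_zero (N := 2 ^ m + 1) fun n hn => ?_)
    rw [finiteChaosCoeff, restrictSeq_apply, if_neg]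
    intro hmem
    obtain ⟨j, hj, rfl⟩ := exists_of_mem_powersUpTo hmem
    have := Nat.pow_le_pow_right two_pos hj
    omega

theorem coeff_mul_congr {c x y : ℕ → ℂ} {m : ℕ} (h : ∀ j, j ≤ m → x j = y j) :
    PowerSeries.coeff m (PowerSeries.mk c * PowerSeries.mk x) =
      PowerSeries.coeff m (PowerSeries.mk c * PowerSeries.mk y) := by
  rw [PowerSeries.coeff_mul, PowerSeries.coeff_mul]
  refine Finset.sum_congr rfl fun p hp => ?_
  have := Finset.HasAntidiagonal.mem_antidiagonal.1 hp
  simp only [PowerSeries.coeff_mk]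
  rw [h p.2 (by omega)]

theorem multishift_two_pow (c ξ : ℕ → ℂ) (m : ℕ) : multishift c ξ (2 ^ m) = PowerSeries.coeff m
    (PowerSeries.mk c * PowerSeries.mk fun j => ξ (2 ^ j)) := by
  simpa using multishift_two_pow_mul c ξ odd_one m

theorem multishift_finiteChaosCoeff (c x : ℕ → ℂ) (m : ℕ) :
    multishift c (finiteChaosCoeff x m) (2 ^ m) =
      PowerSeries.coeff m (PowerSeries.mk c * PowerSeries.mk x) := by
  rw [multishift_two_pow]
  refine coeff_mul_congr fun j hj => ?_
  rw [finiteChaosCoeff_two_pow, if_pos hj]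

theorem norm_le_of_enorm_le {z : ℂ} {C : ℝ≥0} (h : ‖z‖ₑ ≤ C) : ‖z‖ ≤ C := by
  rw [enorm_eq_nnnorm, ENNReal.coe_le_coe] at h
  exact_mod_cast h

/-! ### Necessity: summability of c and of its formal inverse -/

section Necessity

variable {c : ℕ → ℂ} {f : ℝ → ℂ}

/-- Finite chaoses with |x_j| ≤ 1 have norm at most 2, and the coefficient of their image at 2^m is
(c * x)_m. Convolution by c is therefore bounded by 2C, and duality applies. -/
theorem summable_of_multishiftBoundedOn (hf : ∀ t ∈ Set.Ioc (0 : ℝ) 1, f t = firstChaos c t)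
    (hf2 : MemLp f 2 unitMeasure) (h0 : ∫ t, f t ∂unitMeasure = 0) {X : Set (ℝ → ℂ)}
    (hX : X ⊆ dyadicBMO) (hX1 : haarChaos 1 ∩ dyadicVMO ⊆ X) (h : MultishiftBoundedOn f X) :
    Summable fun k => ‖c k‖ := by
  obtain ⟨C, hC⟩ := h
  refine summable_norm_of_convolution_le (C := (C * 2 : ℝ≥0)) fun x hx m => ?_
  obtain ⟨y, hyX, hy, hyC⟩ := hC _ (hX1 (finiteChaos_mem hx m))
  obtain ⟨hy1, hy2, -⟩ := hX hyX
  refine norm_le_of_enorm_le ?_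
  have hm : 1 ≤ 2 ^ m := Nat.one_le_two_pow
  rw [← multishift_finiteChaosCoeff, ← multishift_congr hm
    fun n hn _ => haarCoeff_finiteChaos x m hn,
    ← haarCoeff_of_isMultishiftImage hf hf2 h0 hy1 hy2 hy hm]
  refine (enorm_haarCoeff_le_bmoNorm hy1 hm).trans (hyC.trans ?_)
  push_cast
  gcongr
  exact bmoNorm_finiteChaos_le hx m

/-- Same test functions; the upper estimate of the equivalence plays the role of boundedness of T_f.
-/
theorem summable_of_bmoEquivalent (hf : ∀ t ∈ Set.Ioc (0 : ℝ) 1, f t = firstChaos c t)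
    (hf2 : MemLp f 2 unitMeasure) (h0 : ∫ t, f t ∂unitMeasure = 0) {S : Set ℕ}
    (hS : ∀ j, 2 ^ j ∈ S) (h : BmoEquivalent S (affineTerm f) haarFun) :
    Summable fun k => ‖c k‖ := by
  obtain ⟨_, B, -, h⟩ := h
  refine summable_norm_of_convolution_le (C := (B * 2 : ℝ≥0)) fun x hx m => ?_
  have hF : ∀ n ∈ powersUpTo m, 1 ≤ n := fun n hn => one_le_of_mem_powersUpTo hn
  have hm : 1 ≤ 2 ^ m := Nat.one_le_two_pow
  have h1 := (h (powersUpTo m) (fun n => x (Nat.log 2 n)) (fun n hn => by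
    obtain ⟨j, -, rfl⟩ := exists_of_mem_powersUpTo (Finset.mem_coe.1 hn)
    exact hS j)).2
  refine norm_le_of_enorm_le ?_
  rw [← multishift_finiteChaosCoeff, finiteChaosCoeff,
    ← haarCoeff_sum_affineTerm hf (hf2.integrable (by norm_num)) h0 hF _ hm]
  refine (enorm_haarCoeff_le_bmoNorm (memLp_sum_affineTerm hf2 hF _) hm).trans (h1.trans ?_)
  push_cast
  gcongr
  exact bmoNorm_finiteChaos_le hx m

theorem sum_range_eq_sum_Ico {u : ℕ → ℝ → ℂ} {a : ℕ → ℂ} (ha : a 0 = 0) (N : ℕ) :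
    ∑ n ∈ Finset.range N, a n • u n = ∑ n ∈ Finset.Ico 1 N, a n • u n := by
  symm
  refine Finset.sum_subset (fun n hn => ?_) fun n hn hn' => ?_
  · rw [Finset.mem_Ico] at hn
    exact Finset.mem_range.2 hn.2
  · have : n = 0 := by
      rw [Finset.mem_Ico] at hn'
      rw [Finset.mem_range] at hn
      omega
    rw [this, ha, zero_smul]

/-- A coefficient is bounded by the norm, so convergence in norm and triangularity determine T_f a
coordinatewise. -/
theorem haarCoeff_of_bmo_expansion (hf : ∀ t ∈ Set.Ioc (0 : ℝ) 1, f t = firstChaos c t)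
    (hf2 : MemLp f 2 unitMeasure) (h0 : ∫ t, f t ∂unitMeasure = 0) {x : ℝ → ℂ}
    (hx : MemLp x 2 unitMeasure) {a : ℕ → ℂ} (ha : a 0 = 0)
    (h : Tendsto (fun N : ℕ => bmoNorm (x - ∑ n ∈ Finset.range N, a n • affineTerm f n)) atTop
      (𝓝 0))
    {m : ℕ} (hm : 1 ≤ m) : multishift c a m = haarCoeff x m := by
  simp_rw [sum_range_eq_sum_Ico ha] at h
  have hle : ‖haarCoeff x m - multishift c a m‖ₑ ≤ 0 := by
    refine ge_of_tendsto h (eventually_atTop.2 ⟨m + 1, fun N hN => ?_⟩)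
    have hF : ∀ n ∈ Finset.Ico 1 N, 1 ≤ n := fun n hn => one_le_of_mem_Ico hn
    rw [← haarCoeff_sub_sum_Ico_of_lt hf hf2 h0 hx _ hm hN]
    exact enorm_haarCoeff_le_bmoNorm (hx.sub (memLp_sum_affineTerm hf2 hF _)) hm
  have h1 := le_antisymm hle zero_le
  rw [enorm_eq_zero, sub_eq_zero] at h1
  exact h1.symm

theorem treeEnergy_sub_le (ξ η : ℕ → ℂ) (m : ℕ) :
    treeEnergy (fun n => ξ n - η n) m ≤ 2 * treeEnergy ξ m + 2 * treeEnergy η m := by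
  unfold treeEnergy
  simp_rw [← ENNReal.tsum_mul_left]
  rw [← ENNReal.tsum_add]
  refine ENNReal.tsum_le_tsum fun l => ?_
  rw [mul_left_comm 2, mul_left_comm 2, ← mul_add]
  refine mul_le_mul' le_rfl ?_
  rw [Finset.mul_sum, Finset.mul_sum, ← Finset.sum_add_distrib]
  gcongr with r
  have h1 : ∀ u v : ℂ, ‖u - v‖₊ ^ 2 ≤ 2 * ‖u‖₊ ^ 2 + 2 * ‖v‖₊ ^ 2 := fun u v => by
    rw [← NNReal.coe_le_coe]
    push_cast
    have := norm_sub_le u v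
    nlinarith [norm_nonneg u, norm_nonneg v, norm_nonneg (u - v), sq_nonneg (‖u‖ - ‖v‖)]
  simp only [enorm_eq_nnnorm]
  exact_mod_cast h1 _ _

/-- Expanding a finite chaos x in the basis solves c * a = x along the powers of two, that is, a = d
* x there. The lower estimate of the equivalence bounds the entries of a, so convolution by d is
bounded on bounded sequences. -/
theorem exists_inverse_of_isBasisLikeHaar (hf : ∀ t ∈ Set.Ioc (0 : ℝ) 1, f t = firstChaos c t)
    (hf2 : MemLp f 2 unitMeasure) (h0 : ∫ t, f t ∂unitMeasure = 0) {S : Set ℕ}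
    (hS1 : ∀ n ∈ S, 1 ≤ n) {X : Set (ℝ → ℂ)}
    (hX1 : haarChaos 1 ∩ dyadicVMO ⊆ X) (h : IsBasisLikeHaar f X S) :
    ∃ d : ℕ → ℂ, PowerSeries.mk c * PowerSeries.mk d = 1 ∧ Summable fun k => ‖d k‖ := by
  obtain ⟨⟨-, hbasis⟩, A, _, hA, hequiv⟩ := h
  have hS0 : 0 ∉ S := fun h0 => absurd (hS1 0 h0) (by norm_num)
  have key : ∀ x : ℕ → ℂ, (∀ j, ‖x j‖ ≤ 1) → ∀ m, ∃ a : ℕ → ℂ,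
      (∀ n, 1 ≤ n → multishift c a n = finiteChaosCoeff x m n) ∧
        ∀ n, 1 ≤ n → ‖a n‖ ≤ (4 / A : ℝ≥0) := by
    intro x hx m
    have hmem := memLp_finiteChaos x m
    obtain ⟨a, ⟨haS, hlim⟩, -⟩ := hbasis _ (hX1 (finiteChaos_mem hx m))
    have ha0 : a 0 = 0 := haS 0 hS0
    refine ⟨a, fun n hn => ?_, fun n hn => norm_le_of_enorm_le ?_⟩
    · rw [haarCoeff_of_bmo_expansion hf hf2 h0 hmem ha0 hlim hn, haarCoeff_finiteChaos x m hn]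
    by_cases hnS : n ∈ S
    swap
    · rw [haS n hnS]; simp
    classical
    obtain ⟨N, hN1, hN⟩ := ((ENNReal.tendsto_nhds_zero.1 hlim 1 one_pos).and
      (eventually_ge_atTop (n + 1))).exists
    let F := (Finset.range N).filter (· ∈ S)
    have hFS : (F : Set ℕ) ⊆ S := fun k hk => (Finset.mem_filter.1 hk).2
    have hF : ∀ k ∈ F, 1 ≤ k := fun k hk => hS1 k (hFS hk)
    have hsum : ∑ k ∈ Finset.range N, a k • affineTerm f k = ∑ k ∈ F, a k • affineTerm f k := by
      refine (Finset.sum_subset (Finset.filter_subset _ _) fun k hk hk' => ?_).symm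
      rw [haS k fun hkS => hk' (Finset.mem_filter.2 ⟨hk, hkS⟩), zero_smul]
    rw [hsum] at hN1
    have hmemF := memLp_sum_affineTerm hf2 hF a
    have hz := (bmoNorm_le_iff (hmem.sub hmemF) 1).1 hN1
    -- The partial sum is the test function, of energy at most 2, minus a remainder of norm at most
    -- 1; its energy is at most 2·2 + 2·1 ≤ 4².
    have hbound : bmoNorm (∑ k ∈ F, a k • affineTerm f k) ≤ 4 := by
      rw [bmoNorm_le_iff hmemF]
      intro k hk
      have hcoef : ∀ i, k ≤ i → haarCoeff (∑ k ∈ F, a k • affineTerm f k) i =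
          haarCoeff (finiteChaos x m) i -
            haarCoeff (finiteChaos x m - ∑ k ∈ F, a k • affineTerm f k) i := fun i hi => by
        rw [haarCoeff_sub (hmem.integrable (by norm_num)) (hmemF.integrable (by norm_num))
          (hk.trans hi)]
        ring
      rw [treeEnergy_congr hcoef]
      refine (treeEnergy_sub_le _ _ k).trans ?_
      calc _ ≤ 2 * 2 + 2 * (1 : ℝ≥0∞) ^ 2 :=
            add_le_add (mul_le_mul' le_rfl (treeEnergy_finiteChaos_le hx m k hk))
              (mul_le_mul' le_rfl (hz k hk))
        _ ≤ 4 ^ 2 := by norm_num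
    have h1 := (hequiv F a hFS).1.trans hbound
    have h2 := enorm_haarCoeff_le_bmoNorm (memLp_sum_haarFun hF a) hn
    rw [haarCoeff_sum_haarFun hF a hn, restrictSeq_apply,
      if_pos (Finset.mem_filter.2 ⟨Finset.mem_range.2 hN, hnS⟩)] at h2
    rw [ENNReal.coe_div hA.ne', ENNReal.le_div_iff_mul_le (Or.inl (by exact_mod_cast hA.ne'))
      (Or.inl (by finiteness)), mul_comm]
    exact (mul_le_mul' le_rfl h2).trans h1
  -- Expanding h_1 itself gives c_0 a_1 = 1, so the formal inverse exists.
  have hc0 : c 0 ≠ 0 := by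
    obtain ⟨a, ha, -⟩ := key (fun _ => 1) (by simp) 0
    have h1 := ha (2 ^ 0) le_rfl
    rw [multishift_two_pow, finiteChaosCoeff_two_pow] at h1
    intro hc
    simp [PowerSeries.coeff_mul, hc] at h1
  obtain ⟨d, hd⟩ := exists_mk_mul_eq_one hc0
  refine ⟨d, hd, summable_norm_of_convolution_le (C := (4 / A : ℝ≥0)) fun x hx m => ?_⟩
  obtain ⟨a, ha, hbd⟩ := key x hx m
  have h1 : (PowerSeries.mk c * PowerSeries.mk fun j => a (2 ^ j)) =
      PowerSeries.mk fun j => finiteChaosCoeff x m (2 ^ j) := by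
    ext j
    rw [← multishift_two_pow, PowerSeries.coeff_mk, ha _ Nat.one_le_two_pow]
  have h2 : (PowerSeries.mk fun j => a (2 ^ j)) =
      PowerSeries.mk d * PowerSeries.mk fun j => finiteChaosCoeff x m (2 ^ j) := by
    rw [← h1, ← mul_assoc, mul_comm (PowerSeries.mk d), hd, one_mul]
  have h3 := congrArg (PowerSeries.coeff m) h2
  rw [PowerSeries.coeff_mk, ← multishift_two_pow, multishift_finiteChaosCoeff] at h3
  rw [← h3]
  exact hbd _ Nat.one_le_two_pow

end Necessity

/-! ### Sufficiency: bases from a summable inverse -/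

theorem eq_of_mk_mul_mk_eq_one {c d a ξ : ℕ → ℂ} (hcd : PowerSeries.mk c * PowerSeries.mk d = 1)
    (h : ∀ n, 1 ≤ n → multishift c a n = ξ n) {n : ℕ} (hn : 1 ≤ n) : a n = multishift d ξ n := by
  rw [← multishift_congr hn fun k hk _ => h k hk, multishift_multishift (by rwa [mul_comm]) _ hn]

section Sufficiency

variable {c d : ℕ → ℂ} {f : ℝ → ℂ}

/-- f_n is T_f h_n, and for summable c the multishift preserves bounded and vanishing energies. -/
theorem affineTerm_mem_dyadicVMO (hf : ∀ t ∈ Set.Ioc (0 : ℝ) 1, f t = firstChaos c t)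
    (hf2 : MemLp f 2 unitMeasure) (h0 : ∫ t, f t ∂unitMeasure = 0) (hc : ∑' i, ‖c i‖ₑ ≠ ∞)
    {n : ℕ} (hn : 1 ≤ n) : affineTerm f n ∈ dyadicVMO := by
  have hco : ∀ k, 1 ≤ k → multishift c (Pi.single n 1) k = haarCoeff (affineTerm f n) k :=
    fun k hk => (haarCoeff_affineTerm hf (hf2.integrable (by norm_num)) h0 hn hk).symm
  have hv : VanishingEnergy (Pi.single n 1) :=
    vanishingEnergy_of_eventually_zero (N := n + 1) fun k hk =>
      Pi.single_eq_of_ne (by omega) _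
  exact mem_dyadicVMO_iff.2 ⟨mem_dyadicBMO_iff.2 ⟨memLp_affineTerm hf2 hn,
    integral_affineTerm h0 hn,
    ((bddEnergy_single n).multishift hc).congr hco⟩,
    (hv.multishift hc (bddEnergy_single n)).congr hco⟩

/-- The remainder is the multishift of a tail of a; vanishing energy makes the tail uniformly small
in all subtrees, which is where VMO_d rather than BMO_d is needed. -/
theorem tendsto_bmoNorm_sub_sum (hf : ∀ t ∈ Set.Ioc (0 : ℝ) 1, f t = firstChaos c t)
    (hf2 : MemLp f 2 unitMeasure) (h0 : ∫ t, f t ∂unitMeasure = 0) (hc : ∑' i, ‖c i‖ₑ ≠ ∞)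
    {x : ℝ → ℂ} (hx : MemLp x 2 unitMeasure) {a : ℕ → ℂ} (ha : VanishingEnergy a)
    (hxa : ∀ n, 1 ≤ n → haarCoeff x n = multishift c a n) :
    Tendsto (fun N : ℕ => bmoNorm (x - ∑ n ∈ Finset.Ico 1 N, a n • affineTerm f n)) atTop
      (𝓝 0) := by
  rw [ENNReal.tendsto_nhds_zero]
  intro ε hε
  obtain ⟨δ, hδ, hδε⟩ := exists_pos_mul_le (a := (∑' i, ‖c i‖ₑ) ^ 2 * 2) (ε := ε ^ 2)
    (by finiteness) (ENNReal.pow_pos hε 2).ne'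
  obtain ⟨K, hK⟩ := ha δ hδ
  filter_upwards [eventually_ge_atTop (2 ^ K)] with N hN
  have hF : ∀ n ∈ Finset.Ico 1 N, 1 ≤ n := fun n hn => one_le_of_mem_Ico hn
  rw [bmoNorm_le_iff (hx.sub (memLp_sum_affineTerm hf2 hF a))]
  intro m hm
  rw [treeEnergy_congr fun n hn =>
    haarCoeff_sub_sum_Ico_eq_tail hf hf2 h0 hx hxa N (hm.trans hn)]
  refine (treeEnergy_multishift_le_of_le (treeEnergy_seqTail_le hK hN) m hm).trans ?_
  rwa [← mul_assoc]

/-- If `∑ c_k z^k` has an absolutely summable inverse, then the functions `f_n` form a basis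
equivalent to the Haar system in each space of functions in `VMO_d` with Haar coefficients vanishing
outside a set of indices stable under doubling. -/
theorem isBasisLikeHaar_of_inverse (hf : ∀ t ∈ Set.Ioc (0 : ℝ) 1, f t = firstChaos c t)
    (hf2 : MemLp f 2 unitMeasure) (h0 : ∫ t, f t ∂unitMeasure = 0)
    (hcd : PowerSeries.mk c * PowerSeries.mk d = 1) (hc : Summable fun k => ‖c k‖)
    (hd : Summable fun k => ‖d k‖) {S : Set ℕ} (hS : ∀ n, n ∈ S → 2 * n ∈ S)
    (hS1 : ∀ n ∈ S, 1 ≤ n) {X : Set (ℝ → ℂ)}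
    (hX : ∀ x, x ∈ X ↔ (∀ n, 1 ≤ n → n ∉ S → haarCoeff x n = 0) ∧ x ∈ dyadicVMO) :
    IsBasisLikeHaar f X S := by
  classical
  rw [← tsum_enorm_ne_top_iff] at hc hd
  have hS0 : 0 ∉ S := fun h0 => absurd (hS1 0 h0) (by norm_num)
  have hint : Integrable f unitMeasure := hf2.integrable (by norm_num)
  have hmul : ∀ {n}, 1 ≤ n → ∀ ξ : ℕ → ℂ, multishift c (multishift d ξ) n = ξ n :=
    fun hn ξ => multishift_multishift hcd ξ hn
  refine ⟨⟨fun n hn => (hX _).2 ⟨fun m hm hmS => ?_,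
    affineTerm_mem_dyadicVMO hf hf2 h0 hc (hS1 n hn)⟩, fun x hx => ?_⟩, ?_⟩
  · rw [haarCoeff_affineTerm hf hint h0 (hS1 n hn) hm]
    refine multishift_eq_zero_of_notMem hS (fun k _ hk => ?_) hm hmS
    exact Pi.single_eq_of_ne (M := fun _ => ℂ) (by rintro rfl; exact hk hn) _
  · obtain ⟨hxS, hxV⟩ := (hX x).1 hx
    obtain ⟨hxB, hxv⟩ := mem_dyadicVMO_iff.1 hxV
    obtain ⟨hx2, -, hxb⟩ := mem_dyadicBMO_iff.1 hxB
    -- The cutoff to S enforces the required vanishing but changes no entry of positive index, since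
    -- S is stable under doubling; this is `had`.
    obtain ⟨a, ha⟩ : ∃ a : ℕ → ℂ, a = fun n => if n ∈ S then multishift d (haarCoeff x) n else 0 :=
      ⟨_, rfl⟩
    have haS : ∀ n, n ∉ S → a n = 0 := fun n hn => by rw [ha]; exact if_neg hn
    have had : ∀ n, 1 ≤ n → a n = multishift d (haarCoeff x) n := fun n hn => by
      by_cases hnS : n ∈ S
      · rw [ha]; exact if_pos hnS
      · rw [haS n hnS, multishift_eq_zero_of_notMem hS hxS hn hnS]
    have hav : VanishingEnergy a := (hxv.multishift hd hxb).congr fun n hn => (had n hn).symm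
    refine ⟨a, ⟨haS, ?_⟩, fun b ⟨hbS, hb⟩ => ?_⟩
    · simp_rw [sum_range_eq_sum_Ico (haS 0 hS0)]
      refine tendsto_bmoNorm_sub_sum hf hf2 h0 hc hx2 hav fun n hn => ?_
      rw [multishift_congr hn fun k hk _ => had k hk, hmul hn]
    · funext n
      rcases Nat.eq_zero_or_pos n with rfl | hn
      · rw [hbS 0 hS0, haS 0 hS0]
      · rw [had n hn]
        exact eq_of_mk_mul_mk_eq_one hcd
          (fun k hk => haarCoeff_of_bmo_expansion hf hf2 h0 hx2 (hbS 0 hS0) hb hk) hn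
  · have hD : 2 * ∑' i, ‖d i‖ₑ ≠ ∞ := by finiteness
    have hC : 2 * ∑' i, ‖c i‖ₑ ≠ ∞ := by finiteness
    -- The lower constant comes from bounding T_g, the inverse of T_f, by 2∑|d_i|; adding 1 keeps
    -- the denominator visibly positive.
    refine ⟨((2 * ∑' i, ‖d i‖ₑ).toNNReal + 1)⁻¹, (2 * ∑' i, ‖c i‖ₑ).toNNReal, by positivity,
      fun F a hFS => ?_⟩
    have hF : ∀ n ∈ F, 1 ≤ n := fun n hn => hS1 n (hFS hn)
    have hh := memLp_sum_haarFun hF a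
    have hff := memLp_sum_affineTerm hf2 hF a
    have hco : ∀ n, 1 ≤ n → multishift c (haarCoeff (∑ n ∈ F, a n • haarFun n)) n =
        haarCoeff (∑ n ∈ F, a n • affineTerm f n) n := fun n hn => by
      rw [haarCoeff_sum_affineTerm hf hint h0 hF a hn]
      exact multishift_congr hn fun k hk _ => haarCoeff_sum_haarFun hF a hk
    constructor
    · rw [ENNReal.coe_inv (by positivity), ENNReal.coe_add, ENNReal.coe_toNNReal hD,
        ENNReal.coe_one]
      have h1 := bmoNorm_le_of_multishift hff hh fun n hn => eq_of_mk_mul_mk_eq_one hcd hco hn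
      rw [mul_comm, ← div_eq_mul_inv]
      refine ENNReal.div_le_of_le_mul' (h1.trans ?_)
      gcongr
      exact le_self_add
    · rw [ENNReal.coe_toNNReal hC]
      exact bmoNorm_le_of_multishift hh hff fun n hn => (hco n hn).symm

end Sufficiency

/-! ### Mean zero chaoses of bounded variation -/

theorem hasSum_firstChaos (c : ℕ → ℂ) {t : ℝ} (ht : t ∈ Set.Ioc (0 : ℝ) 1) :
    HasSum (fun k => c k * haarFun (2 ^ k) t) (firstChaos c t) := by
  obtain ⟨m, hm⟩ := exists_mem_dyadic_shell ht
  refine (summable_of_ne_finset_zero (s := Finset.range (m + 1)) fun i hi => ?_).hasSum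
  rw [haarFun_two_pow_eq_zero hm (by simpa using hi), mul_zero]

theorem aestronglyMeasurable_firstChaos (c : ℕ → ℂ) :
    AEStronglyMeasurable (firstChaos c) unitMeasure := by
  refine aestronglyMeasurable_of_tendsto_ae atTop
    (f := fun n t => ∑ k ∈ Finset.range n, c k * haarFun (2 ^ k) t) (fun n => ?_)
    (ae_unitMeasure_of_forall fun t ht => (hasSum_firstChaos c ht).tendsto_sum_nat)
  exact (Finset.measurable_sum _ fun k _ =>
    (measurable_haarFun Nat.one_le_two_pow).const_mul (c k)).aestronglyMeasurable

/-- A mean zero first-order chaos of bounded variation has absolutely summable coefficients. -/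
theorem summable_of_boundedVariationOn_of_integral_eq_zero {c : ℕ → ℂ} {f : ℝ → ℂ}
    (hf : ∀ t ∈ Set.Ioc (0 : ℝ) 1, f t = firstChaos c t) (h : BoundedVariationOn f (Set.Ioc 0 1))
    (h0 : ∫ t, f t ∂unitMeasure = 0) : Summable fun k => ‖c k‖ := by
  have h1 : (1 : ℝ) ∈ Set.Ioc (0 : ℝ) 1 := by simp
  -- Bounded variation makes the function bounded, hence integrable, with no prior assumption on c.
  have hbd : ∀ t ∈ Set.Ioc (0 : ℝ) 1,
      ‖f t‖ ≤ (eVariationOn f (Set.Ioc 0 1)).toReal + ‖f 1‖ := fun t ht => by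
    have h2 := h.dist_le ht h1
    rw [dist_eq_norm] at h2
    have h3 := norm_sub_norm_le (f t) (f 1)
    linarith
  have hmeas : AEStronglyMeasurable f unitMeasure :=
    (aestronglyMeasurable_firstChaos c).congr (ae_unitMeasure_of_forall fun t ht => (hf t ht).symm)
  have hint : Integrable f unitMeasure :=
    Integrable.of_bound hmeas _ (ae_unitMeasure_of_forall hbd)
  refine summable_of_boundedVariationOn hf h
    (M := (eVariationOn f (Set.Ioc 0 1)).toReal + ‖f 1‖) fun k => ?_
  -- Because the mean is zero, c_k is a true Haar coefficient and so is bounded by the supremum of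
  -- |f|; this rules out growth such as c_k = 2^k.
  have hk := haarCoeff_eq_comp f (k := k) (j := 0) (by positivity)
  rw [add_zero, haarCoeff_firstChaos_two_pow k hf hint h0, haarCoeff] at hk
  rw [hk, norm_mul]
  have h4 : ‖∫ t, f (dyadicMap k 0 t) * haarFun 1 t ∂unitMeasure‖ ≤
      ((eVariationOn f (Set.Ioc 0 1)).toReal + ‖f 1‖) * unitMeasure.real Set.univ := by
    refine norm_integral_le_of_norm_le_const (ae_unitMeasure_of_forall fun t ht => ?_)
    rw [norm_mul]
    calc _ ≤ ((eVariationOn f (Set.Ioc 0 1)).toReal + ‖f 1‖) * 1 := by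
          gcongr
          · exact hbd _ (dyadicMap_mem (by positivity) ht)
          · exact norm_haarFun_le le_rfl t
      _ = _ := mul_one _
  simpa using h4

theorem integral_firstChaos {c : ℕ → ℂ} (hc : Summable fun k => ‖c k‖) :
    ∫ t, firstChaos c t ∂unitMeasure = 0 := by
  have hint : ∀ k, Integrable (fun t => c k * haarFun (2 ^ k) t) unitMeasure := fun k =>
    ((memLp_haarFun Nat.one_le_two_pow 1).integrable le_rfl).const_mul _
  unfold firstChaos
  rw [← integral_tsum_of_summable_integral_norm hint]
  · simp [integral_const_mul, integral_haarFun Nat.one_le_two_pow]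
  · refine Summable.of_nonneg_of_le (fun k => integral_nonneg fun t => norm_nonneg _)
      (fun k => ?_) hc
    calc ∫ t, ‖c k * haarFun (2 ^ k) t‖ ∂unitMeasure ≤ ∫ _, ‖c k‖ ∂unitMeasure := by
          refine integral_mono (hint k).norm (integrable_const _) fun t => ?_
          simp only [norm_mul]
          exact mul_le_of_le_one_right (norm_nonneg _) (norm_haarFun_le Nat.one_le_two_pow t)
      _ = ‖c k‖ := by simp

end

theorem proposition4p6 (c : ℕ → ℂ) (f : ℝ → ℂ)
    (hf : ∀ t ∈ Set.Ioc (0 : ℝ) 1, f t = firstChaos c t) (hBMO : f ∈ dyadicBMO) :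
    List.TFAE
      [ MultishiftBoundedOn f dyadicBMO,
        ∀ s : ℕ, 1 ≤ s → MultishiftBoundedOn f (haarChaos s ∩ dyadicBMO),
        MultishiftBoundedOn f (haarChaos 1 ∩ dyadicBMO),
        Summable (fun k => ‖c k‖),
        BoundedVariationOn f (Set.Ioc 0 1) ] ∧
    List.TFAE
      [ IsBasisLikeHaar f dyadicVMO {n | 1 ≤ n},
        ∀ s : ℕ, 1 ≤ s → IsBasisLikeHaar f (haarChaos s ∩ dyadicVMO) (chaosIndex s),
        IsBasisLikeHaar f (haarChaos 1 ∩ dyadicVMO) (chaosIndex 1),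
        Summable (fun k => ‖c k‖) ∧ ∀ z : ℂ, ‖z‖ ≤ 1 → chaosSymbol c z ≠ 0,
        BoundedVariationOn f (Set.Ioc 0 1) ∧
          ∃ d : ℕ → ℂ, IsDualCoeff c d ∧ BoundedVariationOn (firstChaos d) (Set.Ioc 0 1) ∧
            ∫ t, firstChaos d t ∂unitMeasure = 0 ] := by
  obtain ⟨hf2, h0, -⟩ := hBMO
  have hVB : dyadicVMO ⊆ dyadicBMO := fun x hx => hx.1
  have hsuff : ∀ {S : Set ℕ} {X : Set (ℝ → ℂ)}, (∀ n ∈ S, 1 ≤ n) →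
      (∀ j, 2 ^ j ∈ S) → haarChaos 1 ∩ dyadicVMO ⊆ X → IsBasisLikeHaar f X S →
      Summable (fun k => ‖c k‖) ∧ ∀ z : ℂ, ‖z‖ ≤ 1 → chaosSymbol c z ≠ 0 := by
    intro S X hS1 hS hX h
    have hc := summable_of_bmoEquivalent hf hf2 h0 hS h.2
    obtain ⟨d, hcd, hd⟩ := exists_inverse_of_isBasisLikeHaar hf hf2 h0 hS1 hX h
    exact ⟨hc, fun z hz => chaosSymbol_ne_zero hc hd hcd hz⟩
  have hpow : ∀ j, 2 ^ j ∈ chaosIndex 1 := fun j => mem_chaosIndex_one.2 ⟨j, rfl⟩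
  constructor
  · tfae_have 1 → 4 := summable_of_multishiftBoundedOn hf hf2 h0 subset_rfl
      fun x hx => hVB hx.2
    tfae_have 4 → 1 := fun hc => multishiftBoundedOn_of_summable hf hf2 h0 hc
      (S := Set.univ) (by simp) (by simp)
    tfae_have 4 → 2 := fun hc s _ => multishiftBoundedOn_of_summable hf hf2 h0 hc
      (S := chaosIndex s) (fun _ => two_mul_mem_chaosIndex) fun _ => Iff.rfl
    tfae_have 2 → 3 := fun h => h 1 le_rfl
    tfae_have 3 → 4 := summable_of_multishiftBoundedOn hf hf2 h0 Set.inter_subset_right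
      (Set.inter_subset_inter_right _ hVB)
    tfae_have 4 → 5 := boundedVariationOn_of_summable hf
    tfae_have 5 → 4 := fun h => summable_of_boundedVariationOn_of_integral_eq_zero hf h h0
    tfae_finish
  · tfae_have 1 → 4 := hsuff (fun _ hn => hn) (fun _ => Nat.one_le_two_pow) Set.inter_subset_right
    tfae_have 4 → 1 := fun ⟨hc, hz⟩ => by
      obtain ⟨d, hcd, hd⟩ := exists_summable_inverse hc hz
      refine isBasisLikeHaar_of_inverse hf hf2 h0 hcd hc hd (fun n hn => ?_) (fun _ hn => hn)
        fun x => ⟨fun hx => ⟨fun n hn hn' => absurd hn hn', hx⟩, fun hx => hx.2⟩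
      have hn' : 1 ≤ n := hn
      exact (by omega : 1 ≤ 2 * n)
    tfae_have 4 → 2 := fun ⟨hc, hz⟩ s hs => by
      obtain ⟨d, hcd, hd⟩ := exists_summable_inverse hc hz
      exact isBasisLikeHaar_of_inverse hf hf2 h0 hcd hc hd (fun _ => two_mul_mem_chaosIndex)
        (fun _ => one_le_of_mem_chaosIndex hs) fun _ => Iff.rfl
    tfae_have 2 → 3 := fun h => h 1 le_rfl
    tfae_have 3 → 4 := hsuff (fun _ => one_le_of_mem_chaosIndex le_rfl) hpow subset_rfl
    tfae_have 4 → 5 := fun ⟨hc, hz⟩ => by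
      obtain ⟨d, hcd, hd⟩ := exists_summable_inverse hc hz
      exact ⟨boundedVariationOn_of_summable hf hc, d, isDualCoeff_iff.2 hcd,
        boundedVariationOn_of_summable (fun _ _ => rfl) hd, integral_firstChaos hd⟩
    tfae_have 5 → 4 := fun ⟨hfBV, d, hcd, hdBV, hd0⟩ => by
      have hc := summable_of_boundedVariationOn_of_integral_eq_zero hf hfBV h0
      have hd := summable_of_boundedVariationOn_of_integral_eq_zero (fun _ _ => rfl) hdBV hd0
      exact ⟨hc, fun z hz => chaosSymbol_ne_zero hc hd (isDualCoeff_iff.1 hcd) hz⟩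
    tfae_finish
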